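/- Let $G=\mathrm{SU}(2,1)=\{g\in \mathrm{SL}_3(\mathbb C): \bar g^tI_{2,1}g=I_{2,1}\}$, $I_{2,1}=\mathrm{diag}(1,1,-1)$, with real Lie algebra $\mathfrak g$, and let $K\subset G$ be the maximal compact subgroup of block-diagonal matrices (blocks of size $2$ and $1$), with Lie algebra $\mathfrak k$. A $(\mathfrak g,K)$-module is a complex vector space with compatible actions of $\mathfrak g$ and $K$ in which each vector is $K$-finite, $K$ acts continuously on the span of each orbit, and the derivative of the $K$-action is the action of $\mathfrak k$. Let $E_{ij}$ denote the matrix units in $\mathfrak{sl}_3(\mathbb C)=\mathbb C\otimes_{\mathbb R}\mathfrak g$ and put $Z_{12}=2E_{12}$, $Z_{21}=-2E_{21}$, $Z_{ij}=E_{ij}$ for $\{i,j\}=\{1,3\}$ or $\{2,3\}$, $\mathbf C_i=\mathrm{diag}(i,i,-2i)$, $W_0=\mathrm{diag}(i,-i,0)$, $C_K=W_0^2-2iW_0+Z_{12}Z_{21}$. Let $$C=-\tfrac13\mathbf C_i^2+2i\mathbf C_i-W_0^2+2iW_0-Z_{12}Z_{21}+4Z_{13}Z_{31}+4Z_{23}Z_{32}$$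 be the Casimir element. In a $(\mathfrak g,K)$-module $V$ let $V_{h,p}$ ($h\in\mathbb Z$, $p\in\mathbb Z_{\ge0}$) be the subspace on which $\mathbf C_i$ acts as $-ih$ and $C_K$ as $-p(p+2)$, i.e. the part of $K$-type $\tau^h_p$, and let $V_{h,p,p}\subset V_{h,p}$ be its highest weight space, on which $W_0$ acts as $-ip$; its dimension is the multiplicity of $\tau^h_p$ in $V$. A vector $v\in V_{h,p,p}$ is minimal if $v\ne0$ and $$\bigl(Z_{32}+\tfrac1{2(p+1)}Z_{12}Z_{31}\bigr)v=0,\qquad \bigl(Z_{13}-\tfrac1{2(p+1)}Z_{12}Z_{23}\bigr)v=0 .$$ A special module with parameter set $[\mu_2;h_0,p_0;A,B]$, where $\mu_2\in\mathbb C$, $h_0\in\mathbb Z$, $p_0\in\mathbb Z_{\ge0}$, $h_0\equiv p_0\bmod 2$, and $A,B\in\mathbb Z_{\ge0}\cup\{\infty\}$, is a $(\mathfrak g,K)$-module $V$ such that (a) $V$ is generated by a minimal vector in $V_{h_0,p_0,p_0}$; (b) $C$ acts in $V$ as multiplication by $\mu_2$; (c) $V$ is the direct sum of the subspaces $U(\mathfrak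 k)\,Z_{31}^aZ_{23}^b\,V_{h_0,p_0,p_0}$ over all integers $a,b$ with $0\le a\le A$, $0\le b\le B$ (no upper bound if $A$, respectively $B$, is $\infty$), and each of these subspaces is non-zero; (d) each $K$-type that occurs in $V$ has multiplicity one. **Proposition.** Two irreducible special $(\mathfrak g,K)$-modules are isomorphic as $(\mathfrak g,K)$-modules if and only if their parameter sets $[\mu_2;h_0,p_0;A,B]$ are equal. -/

import Mathlib

open Matrix

noncomputable section

attribute [local instance 100] LieRing.ofAssociativeRing

namespace SU21

/-- The diagonal matrix of the hermitian form of signature `(2,1)`. -/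
def I21 : Matrix (Fin 3) (Fin 3) ℂ := !![1, 0, 0; 0, 1, 0; 0, 0, -1]

/-- The underlying matrix of an element of `SL(3, ℂ)`. -/
def slMat (g : SpecialLinearGroup (Fin 3) ℂ) : Matrix (Fin 3) (Fin 3) ℂ := g.1

theorem slMat_mul (g h : SpecialLinearGroup (Fin 3) ℂ) : slMat (g * h) = slMat g * slMat h := rfl

theorem slMat_one : slMat 1 = 1 := rfl

/-- The Lie group `SU(2,1)`, inside `SL(3, ℂ)`. -/
def G : Subgroup (SpecialLinearGroup (Fin 3) ℂ) where
  carrier := {g | (slMat g)ᴴ * I21 * slMat g = I21}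
  one_mem' := by
    show (slMat 1)ᴴ * I21 * slMat 1 = I21
    simp [slMat_one]
  mul_mem' := by
    intro a b (ha : (slMat a)ᴴ * I21 * slMat a = I21) (hb : (slMat b)ᴴ * I21 * slMat b = I21)
    show (slMat (a * b))ᴴ * I21 * slMat (a * b) = I21
    rw [slMat_mul, conjTranspose_mul]
    calc _ = (slMat b)ᴴ * ((slMat a)ᴴ * I21 * slMat a) * slMat b := by
          simp only [Matrix.mul_assoc]
      _ = I21 := by rw [ha, hb]
  inv_mem' := by
    intro a (ha : (slMat a)ᴴ * I21 * slMat a = I21)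
    show (slMat a⁻¹)ᴴ * I21 * slMat a⁻¹ = I21
    have h1 : slMat a * slMat a⁻¹ = 1 := by
      rw [← slMat_mul, mul_inv_cancel, slMat_one]
    have h2 : (slMat a⁻¹)ᴴ * (slMat a)ᴴ = 1 := by
      rw [← conjTranspose_mul, h1, conjTranspose_one]
    calc (slMat a⁻¹)ᴴ * I21 * slMat a⁻¹
        = (slMat a⁻¹)ᴴ * ((slMat a)ᴴ * I21 * slMat a) * slMat a⁻¹ := by
          rw [ha]
      _ = ((slMat a⁻¹)ᴴ * (slMat a)ᴴ) * I21 * (slMat a * slMat a⁻¹) := by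
          simp only [Matrix.mul_assoc]
      _ = I21 := by rw [h1, h2, Matrix.one_mul, Matrix.mul_one]

/-- The underlying complex matrix of an element of `SU(2,1)`. -/
def G.mat (g : G) : Matrix (Fin 3) (Fin 3) ℂ := slMat g.1

theorem G.mat_mul (g h : G) : G.mat (g * h) = G.mat g * G.mat h := rfl

theorem G.mat_one : G.mat 1 = 1 := rfl

theorem G.mat_mul_inv (g : G) : G.mat g * G.mat g⁻¹ = 1 := by
  rw [← G.mat_mul, mul_inv_cancel, G.mat_one]

theorem G.mat_inv_mul (g : G) : G.mat g⁻¹ * G.mat g = 1 := by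
  rw [← G.mat_mul, inv_mul_cancel, G.mat_one]

theorem G.mat_mem (g : G) : (G.mat g)ᴴ * I21 * G.mat g = I21 := g.2

/-- The matrix `k(η, α, β)`. -/
def km (η α β : ℂ) : Matrix (Fin 3) (Fin 3) ℂ :=
  !![η * α, η * β, 0;
     -η * (starRingEnd ℂ) β, η * (starRingEnd ℂ) α, 0;
     0, 0, η⁻¹ ^ 2]

theorem km_mul (η α β η' α' β' : ℂ) :
    km η α β * km η' α' β' =
      km (η * η') (α * α' - β * (starRingEnd ℂ) β') (α * β' + β * (starRingEnd ℂ) α') := by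
  ext i j
  fin_cases i <;> fin_cases j <;>
    simp [km, Matrix.mul_apply, Fin.sum_univ_three] <;> ring

/-- The maximal compact subgroup `K` of `SU(2,1)`: all `k(η, α, β)` with `|η| = 1` and
`|α|² + |β|² = 1`. -/
def K : Subgroup G where
  carrier := {g | ∃ η α β : ℂ, ‖η‖ = 1 ∧ ‖α‖ ^ 2 + ‖β‖ ^ 2 = 1 ∧ G.mat g = km η α β}
  one_mem' := by
    refine ⟨1, 1, 0, by simp, by simp, ?_⟩
    rw [G.mat_one]
    ext i j
    fin_cases i <;> fin_cases j <;> simp [km]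
  mul_mem' := by
    rintro a b ⟨η, α, β, h1, h2, h3⟩ ⟨η', α', β', h1', h2', h3'⟩
    refine ⟨η * η', α * α' - β * (starRingEnd ℂ) β', α * β' + β * (starRingEnd ℂ) α',
      by simp [h1, h1'], ?_, by rw [G.mat_mul, h3, h3', km_mul]⟩
    simp only [← Complex.normSq_eq_norm_sq, Complex.normSq_apply] at *
    simp
    linear_combination (α'.re * α'.re + α'.im * α'.im + (β'.re * β'.re + β'.im * β'.im)) * h2 + h2'
  inv_mem' := by
    rintro a ⟨η, α, β, h1, h2, h3⟩
    have hη : η ≠ 0 := by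
      intro h
      simp [h] at h1
    have hc : α * (starRingEnd ℂ) α + β * (starRingEnd ℂ) β = 1 := by
      rw [Complex.mul_conj, Complex.mul_conj, Complex.normSq_eq_norm_sq,
        Complex.normSq_eq_norm_sq]
      exact_mod_cast h2
    refine ⟨η⁻¹, (starRingEnd ℂ) α, -β, by simp [h1], by simpa using h2, ?_⟩
    have key : G.mat a * km η⁻¹ ((starRingEnd ℂ) α) (-β) = 1 := by
      rw [h3, km_mul]
      ext i j
      fin_cases i <;> fin_cases j <;> simp [km, hη, hc] <;> ring
    calc G.mat a⁻¹ = G.mat a⁻¹ * (G.mat a * km η⁻¹ ((starRingEnd ℂ) α) (-β)) := by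
          rw [key, Matrix.mul_one]
      _ = _ := by rw [← Matrix.mul_assoc, G.mat_inv_mul, Matrix.one_mul]

/-- The real Lie algebra `𝔤` of `SU(2,1)`. -/
def 𝔤 : LieSubalgebra ℝ (Matrix (Fin 3) (Fin 3) ℂ) where
  carrier := {X | Xᴴ * I21 + I21 * X = 0 ∧ X.trace = 0}
  zero_mem' := by simp
  add_mem' := by
    rintro X Y ⟨h1, h2⟩ ⟨h1', h2'⟩
    refine ⟨?_, by simp [h2, h2']⟩
    rw [conjTranspose_add, Matrix.add_mul, Matrix.mul_add, add_add_add_comm, h1, h1', add_zero]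
  smul_mem' := by
    rintro c X ⟨h1, h2⟩
    refine ⟨?_, by simp [h2]⟩
    rw [conjTranspose_smul, star_trivial, Matrix.smul_mul, Matrix.mul_smul, ← smul_add, h1,
      smul_zero]
  lie_mem' := by
    rintro X Y ⟨h1, h2⟩ ⟨h1', h2'⟩
    refine ⟨?_, ?_⟩
    · have e1 : Xᴴ * I21 = -(I21 * X) := eq_neg_of_add_eq_zero_left h1
      have e2 : Yᴴ * I21 = -(I21 * Y) := eq_neg_of_add_eq_zero_left h1'
      rw [Ring.lie_def, conjTranspose_sub, conjTranspose_mul, conjTranspose_mul, Matrix.sub_mul,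
        Matrix.mul_assoc, Matrix.mul_assoc, e1, e2, Matrix.mul_neg, Matrix.mul_neg,
        ← Matrix.mul_assoc, ← Matrix.mul_assoc, e1, e2, Matrix.mul_sub]
      simp only [Matrix.neg_mul, Matrix.mul_assoc]
      abel
    · rw [Ring.lie_def, trace_sub, trace_mul_comm, sub_self]

/-- The adjoint action `X ↦ g X g⁻¹` of `SU(2,1)` on its Lie algebra. -/
def Ad (g : G) (X : 𝔤) : 𝔤 :=
  ⟨G.mat g * (X : Matrix (Fin 3) (Fin 3) ℂ) * G.mat g⁻¹, by
    have h1 : (X : Matrix (Fin 3) (Fin 3) ℂ)ᴴ * I21 + I21 * (X : Matrix (Fin 3) (Fin 3) ℂ) = 0 :=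
      X.2.1
    have h2 : (X : Matrix (Fin 3) (Fin 3) ℂ).trace = 0 := X.2.2
    generalize (X : Matrix (Fin 3) (Fin 3) ℂ) = X at h1 h2
    have e1 : Xᴴ * I21 = -(I21 * X) := eq_neg_of_add_eq_zero_left h1
    have e2 : (G.mat g⁻¹)ᴴ * I21 = I21 * G.mat g := by
      calc (G.mat g⁻¹)ᴴ * I21
          = (G.mat g⁻¹)ᴴ * I21 * (G.mat g⁻¹ * G.mat g) := by
            rw [G.mat_inv_mul, Matrix.mul_one]
        _ = ((G.mat g⁻¹)ᴴ * I21 * G.mat g⁻¹) * G.mat g := by simp only [Matrix.mul_assoc]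
        _ = _ := by rw [G.mat_mem]
    have e3 : (G.mat g)ᴴ * I21 = I21 * G.mat g⁻¹ := by
      calc (G.mat g)ᴴ * I21
          = (G.mat g)ᴴ * I21 * (G.mat g * G.mat g⁻¹) := by
            rw [G.mat_mul_inv, Matrix.mul_one]
        _ = ((G.mat g)ᴴ * I21 * G.mat g) * G.mat g⁻¹ := by simp only [Matrix.mul_assoc]
        _ = _ := by rw [G.mat_mem]
    refine ⟨?_, ?_⟩
    · rw [conjTranspose_mul, conjTranspose_mul, Matrix.mul_assoc, Matrix.mul_assoc, e3,
        ← Matrix.mul_assoc Xᴴ, e1, Matrix.neg_mul, Matrix.mul_neg, ← Matrix.mul_assoc,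
        ← Matrix.mul_assoc, e2]
      simp only [Matrix.mul_assoc]
      abel
    · rw [trace_mul_comm, ← Matrix.mul_assoc, G.mat_inv_mul, Matrix.one_mul]
      exact h2⟩

open Complex (I)

/-- `CK_i`, which spans the Lie algebra of the center of `K`. -/
def CKi : 𝔤 := ⟨!![I, 0, 0; 0, I, 0; 0, 0, -2 * I], by
  constructor
  · ext i j
    fin_cases i <;> fin_cases j <;> simp [I21, Matrix.mul_apply, Fin.sum_univ_three, map_ofNat]
  · simp [Matrix.trace, Fin.sum_univ_three]; ring⟩

/-- `W₀`. -/
def W0 : 𝔤 := ⟨!![I, 0, 0; 0, -I, 0; 0, 0, 0], by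
  constructor
  · ext i j
    fin_cases i <;> fin_cases j <;> simp [I21, Matrix.mul_apply, Fin.sum_univ_three]
  · simp [Matrix.trace, Fin.sum_univ_three]⟩

/-- `W₁`. -/
def W1 : 𝔤 := ⟨!![0, 1, 0; -1, 0, 0; 0, 0, 0], by
  constructor
  · ext i j
    fin_cases i <;> fin_cases j <;> simp [I21, Matrix.mul_apply, Fin.sum_univ_three]
  · simp [Matrix.trace, Fin.sum_univ_three]⟩

/-- `W₂`. -/
def W2 : 𝔤 := ⟨!![0, I, 0; I, 0, 0; 0, 0, 0], by
  constructor
  · ext i j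
    fin_cases i <;> fin_cases j <;> simp [I21, Matrix.mul_apply, Fin.sum_univ_three]
  · simp [Matrix.trace, Fin.sum_univ_three]⟩

/-- `H_r`. -/
def Hr : 𝔤 := ⟨!![0, 0, 1; 0, 0, 0; 1, 0, 0], by
  constructor
  · ext i j
    fin_cases i <;> fin_cases j <;> simp [I21, Matrix.mul_apply, Fin.sum_univ_three]
  · simp [Matrix.trace, Fin.sum_univ_three]⟩

/-- `H_i`. -/
def Hi : 𝔤 := ⟨!![I, 0, 0; 0, -2 * I, 0; 0, 0, I], by
  constructor
  · ext i j
    fin_cases i <;> fin_cases j <;> simp [I21, Matrix.mul_apply, Fin.sum_univ_three, map_ofNat]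
  · simp [Matrix.trace, Fin.sum_univ_three]; ring⟩

/-- `X₀`. -/
def X0 : 𝔤 := ⟨!![I / 2, 0, -(I / 2); 0, 0, 0; I / 2, 0, -(I / 2)], by
  constructor
  · ext i j
    fin_cases i <;> fin_cases j <;>
      simp [I21, Matrix.mul_apply, Fin.sum_univ_three, map_ofNat] <;> ring
  · simp [Matrix.trace, Fin.sum_univ_three]⟩

/-- `X₁`. -/
def X1 : 𝔤 := ⟨!![0, 1, 0; -1, 0, 1; 0, 1, 0], by
  constructor
  · ext i j
    fin_cases i <;> fin_cases j <;> simp [I21, Matrix.mul_apply, Fin.sum_univ_three]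
  · simp [Matrix.trace, Fin.sum_univ_three]⟩

/-- `X₂`. -/
def X2 : 𝔤 := ⟨!![0, I, 0; I, 0, -I; 0, I, 0], by
  constructor
  · ext i j
    fin_cases i <;> fin_cases j <;> simp [I21, Matrix.mul_apply, Fin.sum_univ_three]
  · simp [Matrix.trace, Fin.sum_univ_three]⟩

/-- The real Lie algebra `𝔨 ⊂ 𝔤` of `K`, as the real span of its basis `CK_i, W₀, W₁, W₂`. -/
def 𝔨 : Submodule ℝ 𝔤 := Submodule.span ℝ {CKi, W0, W1, W2}

/-- A `(𝔤, K)`-module structure on the complex vector space `V`: an action of the real Lie algebra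
`𝔤` and an action of the group `K` by complex linear maps, which are compatible, such that each
vector is `K`-finite, `K` acts continuously on the finite-dimensional space generated by each
vector, and the derivative of the action of `K` is the action of the Lie algebra of `K`.
(On a finite-dimensional subspace, continuity and differentiability may be tested with linear
functionals, and each linear functional on it extends to `V`.) -/
structure GKModule (V : Type*) [AddCommGroup V] [Module ℂ V] where
  /-- the action of `𝔤` -/
  ρ : 𝔤 →ₗ⁅ℝ⁆ Module.End ℂ V
  /-- the action of `K` -/
  π : Representation ℂ K V
  compat : ∀ (k : K) (X : 𝔤) (v : V), π k (ρ X v) = ρ (Ad k X) (π k v)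
  finite : ∀ v : V, FiniteDimensional ℂ (Submodule.span ℂ (Set.range fun k : K => π k v))
  continuous : ∀ (v : V) (φ : Module.Dual ℂ V), Continuous fun k : K => φ (π k v)
  hasDerivAt : ∀ (Y : 𝔤) (c : ℝ → K),
    (∀ t : ℝ, G.mat (c t) = NormedSpace.exp (t • (Y : Matrix (Fin 3) (Fin 3) ℂ))) →
    ∀ (v : V) (φ : Module.Dual ℂ V), HasDerivAt (fun t : ℝ => φ (π (c t) v)) (φ (ρ Y v)) 0

namespace GKModule

variable {V : Type*} [AddCommGroup V] [Module ℂ V] (M : GKModule V)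

/-! Actions on `V` of elements of the complexified Lie algebra and of its enveloping algebra. -/

/-- `Z₁₂ = W₁ - i W₂`. -/
def Z12 : Module.End ℂ V := M.ρ W1 - I • M.ρ W2

/-- `Z₂₁ = W₁ + i W₂`. -/
def Z21 : Module.End ℂ V := M.ρ W1 + I • M.ρ W2

/-- `Z₂₃ = ½(-W₁ - i W₂ + X₁ + i X₂)`. -/
def Z23 : Module.End ℂ V := (1 / 2 : ℂ) • (-M.ρ W1 - I • M.ρ W2 + M.ρ X1 + I • M.ρ X2)

/-- `Z₃₂ = ½(-W₁ + i W₂ + X₁ - i X₂)`. -/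
def Z32 : Module.End ℂ V := (1 / 2 : ℂ) • (-M.ρ W1 + I • M.ρ W2 + M.ρ X1 - I • M.ρ X2)

/-- `Z₁₃ = ½(i H_i - 2 i W₀ + H_r + 2 i X₀)`. -/
def Z13 : Module.End ℂ V :=
  (1 / 2 : ℂ) • (I • M.ρ Hi - (2 * I) • M.ρ W0 + M.ρ Hr + (2 * I) • M.ρ X0)

/-- `Z₃₁ = ½(-i H_i + 2 i W₀ + H_r - 2 i X₀)`. -/
def Z31 : Module.End ℂ V :=
  (1 / 2 : ℂ) • (-(I • M.ρ Hi) + (2 * I) • M.ρ W0 + M.ρ Hr - (2 * I) • M.ρ X0)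

/-- The Casimir element `C_K = W₀² + W₁² + W₂²` of the subgroup `SU(2)` of `K`. -/
def casimirK : Module.End ℂ V := M.ρ W0 * M.ρ W0 + M.ρ W1 * M.ρ W1 + M.ρ W2 * M.ρ W2

/-- The Casimir element `C` of `𝔤`. -/
def casimir : Module.End ℂ V :=
  -((1 / 3 : ℂ) • (M.ρ CKi * M.ρ CKi)) + (2 * I) • M.ρ CKi - M.ρ W0 * M.ρ W0 + (2 * I) • M.ρ W0
    - M.Z12 * M.Z21 + (4 : ℂ) • (M.Z13 * M.Z31) + (4 : ℂ) • (M.Z23 * M.Z32)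

/-- The part `V_{h,p}` of `V` of `K`-type `τ^h_p`, on which `CK_i = -ih` and `C_K = -p(p+2)`. -/
def isotypic (h : ℤ) (p : ℕ) : Submodule ℂ V :=
  LinearMap.ker (M.ρ CKi + (I * (h : ℂ)) • (1 : Module.End ℂ V)) ⊓
    LinearMap.ker (M.casimirK + ((p : ℂ) * ((p : ℂ) + 2)) • (1 : Module.End ℂ V))

/-- The weight space `V_{h,p,q}`, the kernel of `W₀ + iq` in `V_{h,p}`. -/
def weightSpace (h : ℤ) (p : ℕ) (q : ℤ) : Submodule ℂ V :=
  M.isotypic h p ⊓ LinearMap.ker (M.ρ W0 + (I * (q : ℂ)) • (1 : Module.End ℂ V))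

/-- The downward shift operator `S³₋₁`, to be applied to elements of `V_{h,p,p}`. -/
def shiftDownPlus (p : ℕ) : Module.End ℂ V :=
  M.Z32 + (2 * ((p : ℂ) + 1))⁻¹ • (M.Z12 * M.Z31)

/-- The downward shift operator `S⁻³₋₁`, to be applied to elements of `V_{h,p,p}`. -/
def shiftDownMinus (p : ℕ) : Module.End ℂ V :=
  M.Z13 - (2 * ((p : ℂ) + 1))⁻¹ • (M.Z12 * M.Z23)

/-- Minimal vectors in `V_{h,p,p}`. -/
structure IsMinimal (h : ℤ) (p : ℕ) (v : V) : Prop where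
  mem : v ∈ M.weightSpace h p p
  ne_zero : v ≠ 0
  shift_plus : M.shiftDownPlus p v = 0
  shift_minus : M.shiftDownMinus p v = 0

/-- Sub-`(𝔤, K)`-modules. -/
def IsInvariant (U : Submodule ℂ V) : Prop :=
  (∀ (X : 𝔤), ∀ u ∈ U, M.ρ X u ∈ U) ∧ (∀ (k : K), ∀ u ∈ U, M.π k u ∈ U)

/-- Irreducible `(𝔤, K)`-modules: non-zero, without non-trivial submodules. -/
def IsIrreducible : Prop :=
  Nontrivial V ∧ ∀ U : Submodule ℂ V, M.IsInvariant U → U = ⊥ ∨ U = ⊤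

/-- The `U(𝔨)`-submodule generated by a subspace `S`. -/
def kSpan (S : Submodule ℂ V) : Submodule ℂ V :=
  sInf {U | S ≤ U ∧ ∀ Y ∈ 𝔨, ∀ u ∈ U, M.ρ Y u ∈ U}

end GKModule

/-- Parameter sets `[μ₂; h₀, p₀; A, B]`. -/
@[ext]
structure ParameterSet where
  μ₂ : ℂ
  h₀ : ℤ
  p₀ : ℕ
  A : ℕ∞
  B : ℕ∞

namespace GKModule

variable {V : Type*} [AddCommGroup V] [Module ℂ V] (M : GKModule V)

/-- The summand `U(𝔨) Z₃₁^a Z₂₃^b V_{h₀,p₀,p₀}`. -/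
def summand (h₀ : ℤ) (p₀ : ℕ) (a b : ℕ) : Submodule ℂ V :=
  M.kSpan ((M.weightSpace h₀ p₀ p₀).map (M.Z31 ^ a * M.Z23 ^ b))

/-- `M` is a special module with parameter set `P`. -/
structure IsSpecial (P : ParameterSet) : Prop where
  parity : P.h₀ ≡ (P.p₀ : ℤ) [ZMOD 2]
  generated : ∃ v : V, M.IsMinimal P.h₀ P.p₀ v ∧
    ∀ U : Submodule ℂ V, M.IsInvariant U → v ∈ U → U = ⊤
  casimir_eq : ∀ v : V, M.casimir v = P.μ₂ • v
  directSum : DirectSum.IsInternal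
    (fun ab : {ab : ℕ × ℕ // (ab.1 : ℕ∞) ≤ P.A ∧ (ab.2 : ℕ∞) ≤ P.B} =>
      M.summand P.h₀ P.p₀ ab.1.1 ab.1.2)
  summand_ne_bot : ∀ a b : ℕ, (a : ℕ∞) ≤ P.A → (b : ℕ∞) ≤ P.B → M.summand P.h₀ P.p₀ a b ≠ ⊥
  /-- each `K`-type has multiplicity at most one (the multiplicity of the `K`-type `τ^h_p` is the
  dimension of its highest weight space) -/
  multiplicity : ∀ (h : ℤ) (p : ℕ), Module.rank ℂ (M.weightSpace h p p) ≤ 1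

/-- Isomorphism of `(𝔤, K)`-modules. -/
def Isomorphic {W : Type*} [AddCommGroup W] [Module ℂ W] (N : GKModule W) : Prop :=
  ∃ e : V ≃ₗ[ℂ] W, (∀ (X : 𝔤) (v : V), e (M.ρ X v) = N.ρ X (e v)) ∧
    ∀ (k : K) (v : V), e (M.π k v) = N.π k (e v)

end GKModule

end SU21

end

noncomputable section

attribute [local instance 100] LieRing.ofAssociativeRing

set_option linter.unusedSimpArgs false
set_option linter.unnecessarySeqFocus false

namespace SU21

open Complex (I)

namespace GKModule

variable {V : Type*} [AddCommGroup V] [Module ℂ V] (M : GKModule V)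

/-! ### The action of the complexified Lie algebra -/

/-! An isomorphism preserves the set of occurring K-types and the Casimir scalar, and these recover
the parameters. The types are `(h₀ + 3(a - b), p₀ + a + b)` with `a ≤ A`, `b ≤ B`
(`IsSpecial.weightSpace_ne_bot_iff`). The least `p` occurs only at `(h₀, p₀)`, and the two rays with
`b = 0` or `a = 0` give `A` and `B`.

For the converse, take minimal vectors `x`, `y` of the same type in the two irreducible modules,
with the same Casimir scalar `μ`. In the direct sum, `(x, y)` is again killed by both downward
shifts, and the Casimir still acts by `μ`. Let `U` be the sum of the spaces U(𝔨) Z₃₁^a Z₂₃^b (x, y).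
The Casimir relation makes each downward shift carry such a vector to a multiple of its predecessor
(`IsHighest.shiftDown_pow`), so `U` is stable under 𝔤 (`IsHighest.rho_mem_minimalSpan`), hence under
`K` (`isInvariant_of_rho_mem`). Comparing K-types and weights shows that `U` meets the highest
weight space of type `(h, p)` only in the line through `(x, y)`
(`IsHighest.minimalSpan_inf_weightSpace`). Thus `U` contains neither `(x, 0)` nor `(0, y)`, and by
irreducibility it is the graph of an isomorphism (`isomorphic_of_isMinimal`). -/

/-- `T` is the operator by which the element `A` of the complexification of `𝔤` acts. -/
def ActsAs (A : Matrix (Fin 3) (Fin 3) ℂ) (T : Module.End ℂ V) : Prop :=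
  ∃ X Y : 𝔤, A = (X : Matrix (Fin 3) (Fin 3) ℂ) + I • (Y : Matrix (Fin 3) (Fin 3) ℂ) ∧
    T = M.ρ X + I • M.ρ Y

/-- The hermitian condition is conjugate-linear in one term and linear in the other, so 𝔤 ∩ i𝔤 = 0.
This makes `ActsAs` single-valued. -/
theorem _root_.SU21.eq_zero_of_eq_I_smul {X Y : 𝔤}
    (h : (X : Matrix (Fin 3) (Fin 3) ℂ) = I • (Y : Matrix (Fin 3) (Fin 3) ℂ)) : Y = 0 := by
  have hX : (X : Matrix (Fin 3) (Fin 3) ℂ)ᴴ * I21 + I21 * (X : Matrix (Fin 3) (Fin 3) ℂ) = 0 :=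
    X.2.1
  have hY : (Y : Matrix (Fin 3) (Fin 3) ℂ)ᴴ * I21 + I21 * (Y : Matrix (Fin 3) (Fin 3) ℂ) = 0 :=
    Y.2.1
  rw [h, conjTranspose_smul] at hX
  have e := eq_neg_of_add_eq_zero_left hY
  rw [Matrix.smul_mul, e, Matrix.mul_smul] at hX
  have h2 : I21 * (Y : Matrix (Fin 3) (Fin 3) ℂ) = 0 := by
    have : (2 * I) • (I21 * (Y : Matrix (Fin 3) (Fin 3) ℂ)) = 0 := by
      rw [← hX]
      simp [two_mul, add_smul]
    exact (smul_eq_zero.mp this).resolve_left (by simp)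
  have h3 : I21 * I21 = 1 := by
    ext i j
    fin_cases i <;> fin_cases j <;> simp [I21, Matrix.mul_apply, Fin.sum_univ_three]
  apply Subtype.ext
  calc (Y : Matrix (Fin 3) (Fin 3) ℂ) = I21 * (I21 * (Y : Matrix (Fin 3) (Fin 3) ℂ)) := by
        rw [← Matrix.mul_assoc, h3, Matrix.one_mul]
    _ = 0 := by rw [h2, Matrix.mul_zero]

variable {M}

theorem ActsAs.unique {A : Matrix (Fin 3) (Fin 3) ℂ} {S T : Module.End ℂ V}
    (hS : M.ActsAs A S) (hT : M.ActsAs A T) : S = T := by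
  obtain ⟨X, Y, hA, rfl⟩ := hS
  obtain ⟨X', Y', hA', rfl⟩ := hT
  have h : ((X - X' : 𝔤) : Matrix (Fin 3) (Fin 3) ℂ) =
      I • ((Y' - Y : 𝔤) : Matrix (Fin 3) (Fin 3) ℂ) := by
    have := hA.symm.trans hA'
    push_cast
    rw [smul_sub, sub_eq_sub_iff_add_eq_add, this, add_comm]
  have hY := eq_zero_of_eq_I_smul h
  rw [hY, ZeroMemClass.coe_zero, smul_zero] at h
  have hX : X - X' = 0 := Subtype.ext h
  rw [sub_eq_zero.mp hX, sub_eq_zero.mp hY]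

theorem ActsAs.of_eq {A B : Matrix (Fin 3) (Fin 3) ℂ} {T : Module.End ℂ V}
    (h : M.ActsAs A T) (e : A = B) : M.ActsAs B T := e ▸ h

theorem actsAs_coe (X : 𝔤) : M.ActsAs (X : Matrix (Fin 3) (Fin 3) ℂ) (M.ρ X) :=
  ⟨X, 0, by simp, by simp⟩

theorem ActsAs.add {A B : Matrix (Fin 3) (Fin 3) ℂ} {S T : Module.End ℂ V}
    (hS : M.ActsAs A S) (hT : M.ActsAs B T) : M.ActsAs (A + B) (S + T) := by
  obtain ⟨X, Y, rfl, rfl⟩ := hS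
  obtain ⟨X', Y', rfl, rfl⟩ := hT
  refine ⟨X + X', Y + Y', ?_, ?_⟩
  · push_cast; module
  · simp only [map_add]; module

theorem ActsAs.smul {A : Matrix (Fin 3) (Fin 3) ℂ} {S : Module.End ℂ V}
    (hS : M.ActsAs A S) (c : ℂ) : M.ActsAs (c • A) (c • S) := by
  obtain ⟨X, Y, rfl, rfl⟩ := hS
  have hc : c = (c.re : ℂ) + (c.im : ℂ) * I := (Complex.re_add_im c).symm
  refine ⟨c.re • X - c.im • Y, c.im • X + c.re • Y, ?_, ?_⟩
  · ext i j
    push_cast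
    simp only [Matrix.smul_apply, Matrix.add_apply, Matrix.sub_apply, smul_eq_mul,
      Complex.real_smul]
    linear_combination (X.1 i j + I * Y.1 i j) * hc + c.im * Y.1 i j * Complex.I_mul_I
  · ext v
    simp only [map_sub, map_add, map_smul, LinearMap.smul_apply, LinearMap.add_apply,
      LinearMap.sub_apply, ← Complex.coe_smul]
    match_scalars
    · linear_combination hc
    · linear_combination I * hc + c.im * Complex.I_mul_I

theorem ActsAs.neg {A : Matrix (Fin 3) (Fin 3) ℂ} {S : Module.End ℂ V}
    (hS : M.ActsAs A S) : M.ActsAs (-A) (-S) := by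
  simpa using hS.smul (-1)

theorem ActsAs.sub {A B : Matrix (Fin 3) (Fin 3) ℂ} {S T : Module.End ℂ V}
    (hS : M.ActsAs A S) (hT : M.ActsAs B T) : M.ActsAs (A - B) (S - T) := by
  simpa [sub_eq_add_neg] using hS.add hT.neg

theorem ActsAs.commutator {A B : Matrix (Fin 3) (Fin 3) ℂ} {S T : Module.End ℂ V}
    (hS : M.ActsAs A S) (hT : M.ActsAs B T) : M.ActsAs (A * B - B * A) (S * T - T * S) := by
  obtain ⟨X, Y, rfl, rfl⟩ := hS
  obtain ⟨X', Y', rfl, rfl⟩ := hT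
  refine ⟨⁅X, X'⁆ - ⁅Y, Y'⁆, ⁅X, Y'⁆ + ⁅Y, X'⁆, ?_, ?_⟩
  · push_cast
    simp only [Ring.lie_def, Matrix.add_mul, Matrix.mul_add, Matrix.smul_mul, Matrix.mul_smul, smul_add,
      smul_sub, smul_smul, Complex.I_mul_I]
    module
  · simp only [map_sub, map_add, LieHom.map_lie, Ring.lie_def, add_mul, mul_add, smul_mul_assoc,
      mul_smul_comm, smul_add, smul_sub, smul_smul, Complex.I_mul_I]
    module

variable (M)

theorem actsAs_Z12 : M.ActsAs !![0, 2, 0; 0, 0, 0; 0, 0, 0] M.Z12 := by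
  refine ActsAs.of_eq ((actsAs_coe (M := M) W1).sub ((actsAs_coe W2).smul I)) ?_
  ext i j
  fin_cases i <;> fin_cases j <;> simp [W1, W2] <;> norm_num

theorem actsAs_Z21 : M.ActsAs !![0, 0, 0; -2, 0, 0; 0, 0, 0] M.Z21 := by
  refine ActsAs.of_eq ((actsAs_coe (M := M) W1).add ((actsAs_coe W2).smul I)) ?_
  ext i j
  fin_cases i <;> fin_cases j <;> simp [W1, W2] <;> norm_num

theorem actsAs_Z23 : M.ActsAs !![0, 0, 0; 0, 0, 1; 0, 0, 0] M.Z23 := by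
  refine ActsAs.of_eq ((((((actsAs_coe (M := M) W1).neg).sub ((actsAs_coe W2).smul I)).add
    (actsAs_coe X1)).add ((actsAs_coe X2).smul I)).smul (1 / 2)) ?_
  ext i j
  fin_cases i <;> fin_cases j <;> simp [W1, W2, X1, X2] <;> norm_num

theorem actsAs_Z32 : M.ActsAs !![0, 0, 0; 0, 0, 0; 0, 1, 0] M.Z32 := by
  refine ActsAs.of_eq ((((((actsAs_coe (M := M) W1).neg).add ((actsAs_coe W2).smul I)).add
    (actsAs_coe X1)).sub ((actsAs_coe X2).smul I)).smul (1 / 2)) ?_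
  ext i j
  fin_cases i <;> fin_cases j <;> simp [W1, W2, X1, X2] <;> norm_num

theorem actsAs_Z13 : M.ActsAs !![0, 0, 1; 0, 0, 0; 0, 0, 0] M.Z13 := by
  refine ActsAs.of_eq ((((((actsAs_coe (M := M) Hi).smul I).sub ((actsAs_coe W0).smul (2 * I))).add
    (actsAs_coe Hr)).add ((actsAs_coe X0).smul (2 * I))).smul (1 / 2)) ?_
  ext i j
  fin_cases i <;> fin_cases j <;> simp [Hi, W0, Hr, X0] <;> ring_nf <;> norm_num

theorem actsAs_Z31 : M.ActsAs !![0, 0, 0; 0, 0, 0; 1, 0, 0] M.Z31 := by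
  refine ActsAs.of_eq ((((((actsAs_coe (M := M) Hi).smul I).neg.add ((actsAs_coe W0).smul (2 * I))).add
    (actsAs_coe Hr)).sub ((actsAs_coe X0).smul (2 * I))).smul (1 / 2)) ?_
  ext i j
  fin_cases i <;> fin_cases j <;> simp [Hi, W0, Hr, X0] <;> ring_nf <;> norm_num

theorem actsAs_CKi : M.ActsAs !![I, 0, 0; 0, I, 0; 0, 0, -2 * I] (M.ρ CKi) := actsAs_coe CKi

theorem actsAs_W0 : M.ActsAs !![I, 0, 0; 0, -I, 0; 0, 0, 0] (M.ρ W0) := actsAs_coe W0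

theorem actsAs_zero : M.ActsAs 0 0 := by
  simpa using actsAs_coe (M := M) 0

variable {M}

theorem ActsAs.apply_apply {A B C : Matrix (Fin 3) (Fin 3) ℂ} {R S T : Module.End ℂ V}
    (hS : M.ActsAs A S) (hT : M.ActsAs B T) (hR : M.ActsAs C R) (h : A * B - B * A = C) (v : V) :
    S (T v) = T (S v) + R v := by
  have := (hS.commutator hT).unique (h ▸ hR)
  rw [← this]
  simp

variable (M)

/-! ### Commutation relations in the complexified Lie algebra -/

theorem CKi_Z31 (v : V) : M.ρ CKi (M.Z31 v) = M.Z31 (M.ρ CKi v) - (3 * I) • M.Z31 v := by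
  rw [M.actsAs_CKi.apply_apply M.actsAs_Z31 (M.actsAs_Z31.smul (-3 * I))]
  · simp [sub_eq_add_neg]
  · ext i j
    fin_cases i <;> fin_cases j <;> simp [Matrix.mul_apply, Fin.sum_univ_three] <;> ring

theorem CKi_Z23 (v : V) : M.ρ CKi (M.Z23 v) = M.Z23 (M.ρ CKi v) + (3 * I) • M.Z23 v := by
  rw [M.actsAs_CKi.apply_apply M.actsAs_Z23 (M.actsAs_Z23.smul (3 * I))]
  · simp
  · ext i j
    fin_cases i <;> fin_cases j <;> simp [Matrix.mul_apply, Fin.sum_univ_three] <;> ring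

theorem CKi_Z12 (v : V) : M.ρ CKi (M.Z12 v) = M.Z12 (M.ρ CKi v) := by
  rw [M.actsAs_CKi.apply_apply M.actsAs_Z12 M.actsAs_zero]
  · simp
  · ext i j
    fin_cases i <;> fin_cases j <;> simp [Matrix.mul_apply, Fin.sum_univ_three] <;> ring

theorem CKi_Z21 (v : V) : M.ρ CKi (M.Z21 v) = M.Z21 (M.ρ CKi v) := by
  rw [M.actsAs_CKi.apply_apply M.actsAs_Z21 M.actsAs_zero]
  · simp
  · ext i j
    fin_cases i <;> fin_cases j <;> simp [Matrix.mul_apply, Fin.sum_univ_three] <;> ring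

theorem W0_Z31 (v : V) : M.ρ W0 (M.Z31 v) = M.Z31 (M.ρ W0 v) - I • M.Z31 v := by
  rw [M.actsAs_W0.apply_apply M.actsAs_Z31 (M.actsAs_Z31.smul (-I))]
  · simp [sub_eq_add_neg]
  · ext i j
    fin_cases i <;> fin_cases j <;> simp [Matrix.mul_apply, Fin.sum_univ_three]

theorem W0_Z23 (v : V) : M.ρ W0 (M.Z23 v) = M.Z23 (M.ρ W0 v) - I • M.Z23 v := by
  rw [M.actsAs_W0.apply_apply M.actsAs_Z23 (M.actsAs_Z23.smul (-I))]
  · simp [sub_eq_add_neg]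
  · ext i j
    fin_cases i <;> fin_cases j <;> simp [Matrix.mul_apply, Fin.sum_univ_three]

theorem W0_Z12 (v : V) : M.ρ W0 (M.Z12 v) = M.Z12 (M.ρ W0 v) + (2 * I) • M.Z12 v := by
  rw [M.actsAs_W0.apply_apply M.actsAs_Z12 (M.actsAs_Z12.smul (2 * I))]
  · simp
  · ext i j
    fin_cases i <;> fin_cases j <;> simp [Matrix.mul_apply, Fin.sum_univ_three] <;> ring

theorem W0_Z21 (v : V) : M.ρ W0 (M.Z21 v) = M.Z21 (M.ρ W0 v) - (2 * I) • M.Z21 v := by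
  rw [M.actsAs_W0.apply_apply M.actsAs_Z21 (M.actsAs_Z21.smul (-2 * I))]
  · simp [sub_eq_add_neg]
  · ext i j
    fin_cases i <;> fin_cases j <;> simp [Matrix.mul_apply, Fin.sum_univ_three] <;> ring

theorem Z12_Z21 (v : V) : M.Z12 (M.Z21 v) = M.Z21 (M.Z12 v) + (4 * I) • M.ρ W0 v := by
  rw [M.actsAs_Z12.apply_apply M.actsAs_Z21 (M.actsAs_W0.smul (4 * I))]
  · simp
  · ext i j
    fin_cases i <;> fin_cases j <;> simp [Matrix.mul_apply, Fin.sum_univ_three, mul_assoc] <;>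
      norm_num

theorem Z21_Z31 (v : V) : M.Z21 (M.Z31 v) = M.Z31 (M.Z21 v) := by
  rw [M.actsAs_Z21.apply_apply M.actsAs_Z31 M.actsAs_zero]
  · simp
  · ext i j
    fin_cases i <;> fin_cases j <;> simp [Matrix.mul_apply, Fin.sum_univ_three]

theorem Z21_Z23 (v : V) : M.Z21 (M.Z23 v) = M.Z23 (M.Z21 v) := by
  rw [M.actsAs_Z21.apply_apply M.actsAs_Z23 M.actsAs_zero]
  · simp
  · ext i j
    fin_cases i <;> fin_cases j <;> simp [Matrix.mul_apply, Fin.sum_univ_three]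

theorem Z23_Z31 (v : V) : M.Z23 (M.Z31 v) = M.Z31 (M.Z23 v) - (1 / 2 : ℂ) • M.Z21 v := by
  rw [M.actsAs_Z23.apply_apply M.actsAs_Z31 (M.actsAs_Z21.smul (-(1 / 2)))]
  · simp [sub_eq_add_neg]
  · ext i j
    fin_cases i <;> fin_cases j <;> simp [Matrix.mul_apply, Fin.sum_univ_three]

theorem Z31_Z12 (v : V) : M.Z31 (M.Z12 v) = M.Z12 (M.Z31 v) + (2 : ℂ) • M.Z32 v := by
  rw [M.actsAs_Z31.apply_apply M.actsAs_Z12 (M.actsAs_Z32.smul 2)]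
  · simp
  · ext i j
    fin_cases i <;> fin_cases j <;> simp [Matrix.mul_apply, Fin.sum_univ_three]

theorem Z23_Z12 (v : V) : M.Z23 (M.Z12 v) = M.Z12 (M.Z23 v) - (2 : ℂ) • M.Z13 v := by
  rw [M.actsAs_Z23.apply_apply M.actsAs_Z12 (M.actsAs_Z13.smul (-2))]
  · simp [sub_eq_add_neg]
  · ext i j
    fin_cases i <;> fin_cases j <;> simp [Matrix.mul_apply, Fin.sum_univ_three]

theorem Z31_Z32 (v : V) : M.Z31 (M.Z32 v) = M.Z32 (M.Z31 v) := by
  rw [M.actsAs_Z31.apply_apply M.actsAs_Z32 M.actsAs_zero]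
  · simp
  · ext i j
    fin_cases i <;> fin_cases j <;> simp [Matrix.mul_apply, Fin.sum_univ_three]

theorem Z23_Z13 (v : V) : M.Z23 (M.Z13 v) = M.Z13 (M.Z23 v) := by
  rw [M.actsAs_Z23.apply_apply M.actsAs_Z13 M.actsAs_zero]
  · simp
  · ext i j
    fin_cases i <;> fin_cases j <;> simp [Matrix.mul_apply, Fin.sum_univ_three]

theorem Z31_Z13 (v : V) : M.Z31 (M.Z13 v) =
    M.Z13 (M.Z31 v) + (I / 2) • (M.ρ CKi v + M.ρ W0 v) := by
  rw [M.actsAs_Z31.apply_apply M.actsAs_Z13 ((M.actsAs_CKi.add M.actsAs_W0).smul (I / 2))]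
  · simp
  · ext i j
    fin_cases i <;> fin_cases j <;> simp [Matrix.mul_apply, Fin.sum_univ_three] <;> ring_nf <;>
      simp

theorem Z32_Z23 (v : V) : M.Z32 (M.Z23 v) =
    M.Z23 (M.Z32 v) + (I / 2) • (M.ρ CKi v - M.ρ W0 v) := by
  rw [M.actsAs_Z32.apply_apply M.actsAs_Z23 ((M.actsAs_CKi.sub M.actsAs_W0).smul (I / 2))]
  · simp
  · ext i j
    fin_cases i <;> fin_cases j <;> simp [Matrix.mul_apply, Fin.sum_univ_three] <;> ring_nf <;>
      simp

/-- Expansion in the complex basis; it reduces stability under 𝔤 to eight operators. The halves come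
from Z₁₂ = 2E₁₂ and Z₂₁ = -2E₂₁. -/
theorem rho_eq (X : 𝔤) : M.ρ X =
    (X.1 0 1 / 2) • M.Z12 - (X.1 1 0 / 2) • M.Z21 + X.1 0 2 • M.Z13 + X.1 2 0 • M.Z31 +
      X.1 1 2 • M.Z23 + X.1 2 1 • M.Z32 - (I / 2 * (X.1 0 0 + X.1 1 1)) • M.ρ CKi -
      (I / 2 * (X.1 0 0 - X.1 1 1)) • M.ρ W0 := by
  refine (actsAs_coe X).unique ?_
  have h := (((((((M.actsAs_Z12.smul (X.1 0 1 / 2)).sub (M.actsAs_Z21.smul (X.1 1 0 / 2))).add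
    (M.actsAs_Z13.smul (X.1 0 2))).add (M.actsAs_Z31.smul (X.1 2 0))).add
    (M.actsAs_Z23.smul (X.1 1 2))).add (M.actsAs_Z32.smul (X.1 2 1))).sub
    (M.actsAs_CKi.smul (I / 2 * (X.1 0 0 + X.1 1 1)))).sub
    (M.actsAs_W0.smul (I / 2 * (X.1 0 0 - X.1 1 1)))
  convert h using 1
  have ht : X.1.trace = 0 := X.2.2
  simp only [Matrix.trace, Fin.sum_univ_three, Matrix.diag] at ht
  ext i j
  fin_cases i <;> fin_cases j <;> simp
  · linear_combination X.1 0 0 * Complex.I_mul_I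
  · linear_combination X.1 1 1 * Complex.I_mul_I
  · linear_combination ht - (X.1 0 0 + X.1 1 1) * Complex.I_mul_I

end GKModule

namespace GKModule

variable {V : Type*} [AddCommGroup V] [Module ℂ V] (M : GKModule V)

/-! ### Highest weight vectors and shift operators -/

/-- Z₁₂Z₂₁ = W₁² + W₂² + i[W₁, W₂] and [W₁, W₂] = 2W₀. With Z₂₁ on the right, the last term vanishes
on highest weight vectors. -/
theorem casimirK_eq : M.casimirK = M.ρ W0 * M.ρ W0 - (2 * I) • M.ρ W0 + M.Z12 * M.Z21 := by
  have h : ⁅W1, W2⁆ = (2 : ℝ) • W0 := by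
    apply Subtype.ext
    ext i j
    fin_cases i <;> fin_cases j <;>
      simp [W0, W1, W2, Ring.lie_def, Matrix.mul_apply, Fin.sum_univ_three] <;> ring
  have h' : M.ρ W1 * M.ρ W2 = M.ρ W2 * M.ρ W1 + (2 : ℂ) • M.ρ W0 := by
    have := congrArg M.ρ h
    rw [LieHom.map_lie, Ring.lie_def, sub_eq_iff_eq_add, map_smul, ← Complex.coe_smul] at this
    rw [this, add_comm]
    simp
  simp only [casimirK, Z12, Z21, sub_mul, mul_add, smul_mul_assoc, mul_smul_comm, h', smul_add,
    smul_smul]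
  match_scalars <;> simp <;> ring

/-- `x` is a vector of weight `p` killed by `Z₂₁`, on which `CK_i` acts as `-ih`. -/
structure IsHighest (h : ℤ) (p : ℕ) (x : V) : Prop where
  cki : M.ρ CKi x = -(I * (h : ℂ)) • x
  w0 : M.ρ W0 x = -(I * (p : ℂ)) • x
  z21 : M.Z21 x = 0

theorem mem_weightSpace_iff {h : ℤ} {p : ℕ} {q : ℤ} {x : V} : x ∈ M.weightSpace h p q ↔
    M.ρ CKi x = -(I * (h : ℂ)) • x ∧ M.casimirK x = -((p : ℂ) * (p + 2)) • x ∧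
      M.ρ W0 x = -(I * (q : ℂ)) • x := by
  simp [weightSpace, isotypic, add_eq_zero_iff_eq_neg, and_assoc]

variable {M}

theorem IsHighest.mem_weightSpace {h : ℤ} {p : ℕ} {x : V} (hx : M.IsHighest h p x) :
    x ∈ M.weightSpace h p p := by
  rw [mem_weightSpace_iff]
  refine ⟨hx.cki, ?_, by simpa using hx.w0⟩
  rw [casimirK_eq]
  simp only [LinearMap.add_apply, LinearMap.sub_apply, Module.End.mul_apply, LinearMap.smul_apply,
    hx.w0, hx.z21, map_smul, map_zero, smul_smul, add_zero]
  rw [← sub_smul]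
  congr 1
  linear_combination ((p : ℂ) * p + 2 * p) * Complex.I_mul_I

/-- Z₃₁ commutes with Z₂₁ and is an eigenvector of ad CK_i and ad W₀, so it acts as an upward shift
operator; likewise Z₂₃. -/
theorem IsHighest.z31 {h : ℤ} {p : ℕ} {x : V} (hx : M.IsHighest h p x) :
    M.IsHighest (h + 3) (p + 1) (M.Z31 x) where
  cki := by
    rw [CKi_Z31, hx.cki, map_smul]
    push_cast
    module
  w0 := by
    rw [W0_Z31, hx.w0, map_smul]
    push_cast
    module
  z21 := by rw [Z21_Z31, hx.z21, map_zero]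

theorem IsHighest.z23 {h : ℤ} {p : ℕ} {x : V} (hx : M.IsHighest h p x) :
    M.IsHighest (h - 3) (p + 1) (M.Z23 x) where
  cki := by
    rw [CKi_Z23, hx.cki, map_smul]
    push_cast
    module
  w0 := by
    rw [W0_Z23, hx.w0, map_smul]
    push_cast
    module
  z21 := by rw [Z21_Z23, hx.z21, map_zero]

theorem IsHighest.z23_z31 {h : ℤ} {p : ℕ} {x : V} (hx : M.IsHighest h p x) :
    M.Z23 (M.Z31 x) = M.Z31 (M.Z23 x) := by
  rw [Z23_Z31, hx.z21, smul_zero, sub_zero]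

theorem IsHighest.pow {h : ℤ} {p : ℕ} {x : V} (hx : M.IsHighest h p x) (a b : ℕ) :
    M.IsHighest (h + 3 * ((a : ℤ) - b)) (p + a + b) ((M.Z31 ^ a * M.Z23 ^ b) x) := by
  induction a with
  | zero =>
    induction b with
    | zero => simpa using hx
    | succ b ih =>
      rw [pow_zero, one_mul] at ih ⊢
      rw [pow_succ', Module.End.mul_apply]
      convert ih.z23 using 1
      · push_cast
        ring
      · ring
  | succ a ih =>
    rw [pow_succ', mul_assoc, Module.End.mul_apply]
    convert ih.z31 using 1
    · push_cast
      ring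
    · ring

theorem IsHighest.z23_pow {h : ℤ} {p : ℕ} {x : V} (hx : M.IsHighest h p x) (a b : ℕ) :
    M.Z23 ((M.Z31 ^ a * M.Z23 ^ b) x) = (M.Z31 ^ a * M.Z23 ^ (b + 1)) x := by
  induction a with
  | zero => simp [pow_succ']
  | succ a ih =>
    rw [pow_succ', mul_assoc, Module.End.mul_apply, (hx.pow a b).z23_z31, ih]
    simp only [mul_assoc, Module.End.mul_apply, pow_succ' M.Z31]

theorem z31_pow (a b : ℕ) (x : V) :
    M.Z31 ((M.Z31 ^ a * M.Z23 ^ b) x) = (M.Z31 ^ (a + 1) * M.Z23 ^ b) x := by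
  simp [pow_succ']

/-- All other terms of the Casimir act by scalars on a highest weight vector; the subtracted
polynomial in `h` and `p` is their sum. -/
theorem IsHighest.casimir {h : ℤ} {p : ℕ} {x : V} (hx : M.IsHighest h p x) {μ : ℂ}
    (hμ : M.casimir x = μ • x) : M.Z13 (M.Z31 x) + M.Z23 (M.Z32 x) =
      ((μ - ((h : ℂ) * h / 3 + 2 * h + p * p + 2 * p)) / 4) • x := by
  simp only [GKModule.casimir, LinearMap.add_apply, LinearMap.sub_apply, LinearMap.neg_apply,
    Module.End.mul_apply, LinearMap.smul_apply, hx.w0, hx.cki, hx.z21, map_smul, map_zero,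
    smul_smul, sub_zero] at hμ
  have h4 : (4 : ℂ) • (M.Z13 (M.Z31 x) + M.Z23 (M.Z32 x)) =
      (μ - ((h : ℂ) * h / 3 + 2 * h + p * p + 2 * p)) • x := by
    rw [sub_smul, ← hμ, ← sub_eq_zero]
    match_scalars
    · ring
    · ring
    · linear_combination ((h : ℂ) * h / 3 + 2 * h + p * p + 2 * p) * Complex.I_mul_I
  rw [div_eq_inv_mul, mul_smul, ← h4, smul_smul]
  norm_num

/-- Moving Z₃₁ to the right past Z₁₂ produces 2Z₃₂, which changes the coefficient of Z₃₂Z₃₁ from 1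
to (p+2)/(p+1). -/
theorem shiftDownPlus_Z31 (p : ℕ) (x : V) : M.shiftDownPlus (p + 1) (M.Z31 x) =
    (((p : ℂ) + 1) / (p + 2)) • M.Z31 (M.shiftDownPlus p x) := by
  have h1 : (p : ℂ) + 1 ≠ 0 := by exact_mod_cast Nat.succ_ne_zero p
  have h2 : (p : ℂ) + 2 ≠ 0 := by exact_mod_cast Nat.succ_ne_zero (p + 1)
  have h3 : (p : ℂ) + 1 + 1 ≠ 0 := by exact_mod_cast Nat.succ_ne_zero (p + 1)
  simp only [shiftDownPlus, LinearMap.add_apply, LinearMap.smul_apply, Module.End.mul_apply,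
    map_add, map_smul, Z31_Z12, Z31_Z32]
  push_cast
  match_scalars
  · field_simp
    ring
  · field_simp
    ring

theorem shiftDownMinus_Z23 (p : ℕ) (x : V) : M.shiftDownMinus (p + 1) (M.Z23 x) =
    (((p : ℂ) + 1) / (p + 2)) • M.Z23 (M.shiftDownMinus p x) := by
  have h1 : (p : ℂ) + 1 ≠ 0 := by exact_mod_cast Nat.succ_ne_zero p
  have h2 : (p : ℂ) + 2 ≠ 0 := by exact_mod_cast Nat.succ_ne_zero (p + 1)
  have h3 : (p : ℂ) + 1 + 1 ≠ 0 := by exact_mod_cast Nat.succ_ne_zero (p + 1)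
  simp only [shiftDownMinus, LinearMap.sub_apply, LinearMap.smul_apply, Module.End.mul_apply,
    map_sub, map_smul, Z23_Z12, Z23_Z13]
  push_cast
  match_scalars
  · field_simp
    ring
  · field_simp
    ring

/-- The Z₁₂Z₂₃Z₃₁ terms cancel against those of Z₂₃ applied to the other shift. What remains is a
multiple of (Z₁₃Z₃₁ + Z₂₃Z₃₂)x, a scalar multiple of `x` by the Casimir relation. -/
theorem IsHighest.shiftDownMinus_Z31 {h : ℤ} {p : ℕ} {x : V} (hx : M.IsHighest h p x) {μ : ℂ}
    (hμ : M.casimir x = μ • x) : ∃ c : ℂ, M.shiftDownMinus (p + 1) (M.Z31 x) =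
      c • x - (((p : ℂ) + 1) / (p + 2)) • M.Z23 (M.shiftDownPlus p x) := by
  have h1 : (p : ℂ) + 1 ≠ 0 := by exact_mod_cast Nat.succ_ne_zero p
  have h2 : (p : ℂ) + 2 ≠ 0 := by exact_mod_cast Nat.succ_ne_zero (p + 1)
  have h3 : (p : ℂ) + 1 + 1 ≠ 0 := by exact_mod_cast Nat.succ_ne_zero (p + 1)
  refine ⟨((p : ℂ) + 1) / (p + 2) *
    ((μ - ((h : ℂ) * h / 3 + 2 * h + p * p + 2 * p)) / 4), ?_⟩
  rw [mul_smul, ← hx.casimir hμ]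
  simp only [shiftDownPlus, shiftDownMinus, LinearMap.sub_apply, LinearMap.add_apply,
    LinearMap.smul_apply, Module.End.mul_apply, map_add, map_smul, Z23_Z12]
  push_cast
  match_scalars
  · field_simp
    ring
  · field_simp
    ring
  · field_simp
    ring

theorem IsHighest.shiftDownPlus_Z23 {h : ℤ} {p : ℕ} {x : V} (hx : M.IsHighest h p x) {μ : ℂ}
    (hμ : M.casimir x = μ • x) : ∃ c : ℂ, M.shiftDownPlus (p + 1) (M.Z23 x) =
      c • x - (((p : ℂ) + 1) / (p + 2)) • M.Z31 (M.shiftDownMinus p x) := by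
  have h1 : (p : ℂ) + 1 ≠ 0 := by exact_mod_cast Nat.succ_ne_zero p
  have h2 : (p : ℂ) + 2 ≠ 0 := by exact_mod_cast Nat.succ_ne_zero (p + 1)
  have h3 : (p : ℂ) + 1 + 1 ≠ 0 := by exact_mod_cast Nat.succ_ne_zero (p + 1)
  -- Here the remainder is Z₃₁Z₁₃ + Z₃₂Z₂₃; reordering adds i·CK_i, which acts as `h`.
  refine ⟨((p : ℂ) + 1) / (p + 2) *
    ((μ - ((h : ℂ) * h / 3 + 2 * h + p * p + 2 * p)) / 4 + h), ?_⟩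
  rw [mul_smul, add_smul, ← hx.casimir hμ]
  simp only [shiftDownPlus, shiftDownMinus, LinearMap.sub_apply, LinearMap.add_apply,
    LinearMap.smul_apply, Module.End.mul_apply, map_sub, map_smul, Z31_Z12, Z31_Z13, Z32_Z23,
    hx.cki, hx.w0]
  push_cast
  match_scalars
  · field_simp
    ring
  · field_simp
    linear_combination (-2 * (h : ℂ) * (p + 1)) * Complex.I_mul_I
  · field_simp
    ring
  · field_simp
    ring

theorem shiftDownPlus_Z31_pow {p : ℕ} {x : V} (hp : M.shiftDownPlus p x = 0) (a : ℕ) :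
    M.shiftDownPlus (p + a) ((M.Z31 ^ a) x) = 0 := by
  induction a with
  | zero => simpa using hp
  | succ a ih => rw [pow_succ', Module.End.mul_apply, ← add_assoc, shiftDownPlus_Z31, ih, map_zero,
      smul_zero]

theorem shiftDownMinus_Z23_pow {p : ℕ} {x : V} (hp : M.shiftDownMinus p x = 0) (b : ℕ) :
    M.shiftDownMinus (p + b) ((M.Z23 ^ b) x) = 0 := by
  induction b with
  | zero => simpa using hp
  | succ b ih => rw [pow_succ', Module.End.mul_apply, ← add_assoc, shiftDownMinus_Z23, ih, map_zero,
      smul_zero]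

/-- The downward shifts of the vectors `Z₃₁^a Z₂₃^b x`, for a minimal vector `x`. -/
theorem IsHighest.shiftDown_pow {h : ℤ} {p : ℕ} {x : V} (hx : M.IsHighest h p x) {μ : ℂ}
    (hμ : ∀ v, M.casimir v = μ • v) (hp : M.shiftDownPlus p x = 0)
    (hm : M.shiftDownMinus p x = 0) (a b : ℕ) :
    (∃ c : ℂ, M.shiftDownPlus (p + a + (b + 1)) ((M.Z31 ^ a * M.Z23 ^ (b + 1)) x) =
      c • (M.Z31 ^ a * M.Z23 ^ b) x) ∧
    ∃ c : ℂ, M.shiftDownMinus (p + (a + 1) + b) ((M.Z31 ^ (a + 1) * M.Z23 ^ b) x) =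
      c • (M.Z31 ^ a * M.Z23 ^ b) x := by
  -- Each downward shift is expressed through the other one in total degree one less, so both claims
  -- go by a joint induction on `a + b`. On the boundary `a = 0` or `b = 0` the other shift
  -- vanishes.
  induction hn : a + b using Nat.strong_induction_on generalizing a b with
  | _ n ih =>
  constructor
  · obtain ⟨c, hc⟩ := (hx.pow a b).shiftDownPlus_Z23 (hμ _)
    rw [← hx.z23_pow, ← add_assoc, hc]
    cases a with
    | zero =>
      refine ⟨c, ?_⟩
      simp [shiftDownMinus_Z23_pow hm b]
    | succ a =>
      obtain ⟨-, d, hd⟩ := ih (a + b) (by omega) a b rfl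
      rw [hd, map_smul, z31_pow, smul_smul, ← sub_smul]
      exact ⟨_, rfl⟩
  · obtain ⟨c, hc⟩ := (hx.pow a b).shiftDownMinus_Z31 (hμ _)
    rw [← z31_pow, show p + (a + 1) + b = p + a + b + 1 by ring, hc]
    cases b with
    | zero =>
      refine ⟨c, ?_⟩
      simp [shiftDownPlus_Z31_pow hp a]
    | succ b =>
      obtain ⟨⟨d, hd⟩, -⟩ := ih (a + b) (by omega) a b rfl
      rw [hd, map_smul, hx.z23_pow, smul_smul, ← sub_smul]
      exact ⟨_, rfl⟩

end GKModule

/-- A vector of an eigenspace which lies in a sum of subspaces of eigenspaces lies in the sum of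
those that belong to its own eigenvalue. -/
theorem mem_iSup_of_mem_eigenspace {V ι : Type*} [AddCommGroup V] [Module ℂ V]
    {T : Module.End ℂ V} {F : ι → Submodule ℂ V} {l : ι → ℂ} (hF : ∀ i, F i ≤ T.eigenspace (l i))
    {ν : ℂ} {v : V} (hv : v ∈ ⨆ i, F i) (hν : v ∈ T.eigenspace ν) :
    v ∈ ⨆ (i) (_ : l i = ν), F i := by
  have hle : ⨆ i, F i ≤ (⨆ (i) (_ : l i = ν), F i) ⊔ ⨆ (i) (_ : l i ≠ ν), F i := by
    refine iSup_le fun i => ?_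
    by_cases h : l i = ν
    · exact le_sup_of_le_left (le_iSup₂_of_le i h le_rfl)
    · exact le_sup_of_le_right (le_iSup₂_of_le i h le_rfl)
  obtain ⟨g, hg, k, hk, rfl⟩ := Submodule.mem_sup.mp (hle hv)
  have hg' : g ∈ T.eigenspace ν :=
    (iSup₂_le fun i (h : l i = ν) => h ▸ hF i : (⨆ (i) (_ : l i = ν), F i) ≤ _) hg
  -- The part `k` from the other eigenvalues is `v - g`, hence also a `ν`-eigenvector; independence
  -- of eigenspaces makes it zero.
  have hk' : k ∈ T.eigenspace ν := by simpa using sub_mem hν hg'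
  have hk'' : k ∈ ⨆ (κ) (_ : κ ≠ ν), T.eigenspace κ :=
    (iSup₂_le fun i h => (hF i).trans (le_iSup₂_of_le (l i) h le_rfl) :
      (⨆ (i) (_ : l i ≠ ν), F i) ≤ _) hk
  have : k = 0 := Submodule.disjoint_def.mp (T.eigenspaces_iSupIndep ν) k hk' hk''
  rwa [this, add_zero]

namespace GKModule

variable {V : Type*} [AddCommGroup V] [Module ℂ V] (M : GKModule V)

/-! ### Subspaces that are stable under `𝔨` -/

/-- `U` is stable under `𝔨`. -/
def IsKStable (U : Submodule ℂ V) : Prop := ∀ Y ∈ 𝔨, ∀ u ∈ U, M.ρ Y u ∈ U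

variable {M}

theorem isKStable_of_generators {U : Submodule ℂ V} (hC : ∀ u ∈ U, M.ρ CKi u ∈ U)
    (h0 : ∀ u ∈ U, M.ρ W0 u ∈ U) (h1 : ∀ u ∈ U, M.ρ W1 u ∈ U) (h2 : ∀ u ∈ U, M.ρ W2 u ∈ U) :
    M.IsKStable U := by
  intro Y hY
  induction hY using Submodule.span_induction with
  | mem Y hY =>
    simp only [Set.mem_insert_iff, Set.mem_singleton_iff] at hY
    rcases hY with rfl | rfl | rfl | rfl
    exacts [hC, h0, h1, h2]
  | zero => simp
  | add X Y _ _ hX hY =>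
    intro u hu
    rw [map_add]
    exact U.add_mem (hX u hu) (hY u hu)
  | smul c X _ hX =>
    intro u hu
    rw [map_smul, ← Complex.coe_smul]
    exact U.smul_mem _ (hX u hu)

theorem cki_mem : CKi ∈ 𝔨 := Submodule.subset_span (by simp)
theorem w0_mem : W0 ∈ 𝔨 := Submodule.subset_span (by simp)
theorem w1_mem : W1 ∈ 𝔨 := Submodule.subset_span (by simp)
theorem w2_mem : W2 ∈ 𝔨 := Submodule.subset_span (by simp)

theorem IsKStable.z12 {U : Submodule ℂ V} (h : M.IsKStable U) {u : V} (hu : u ∈ U) :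
    M.Z12 u ∈ U :=
  U.sub_mem (h _ w1_mem u hu) (U.smul_mem _ (h _ w2_mem u hu))

theorem IsKStable.z21 {U : Submodule ℂ V} (h : M.IsKStable U) {u : V} (hu : u ∈ U) :
    M.Z21 u ∈ U :=
  U.add_mem (h _ w1_mem u hu) (U.smul_mem _ (h _ w2_mem u hu))

theorem isKStable_of_Z {U : Submodule ℂ V} (hC : ∀ u ∈ U, M.ρ CKi u ∈ U)
    (h0 : ∀ u ∈ U, M.ρ W0 u ∈ U) (h12 : ∀ u ∈ U, M.Z12 u ∈ U) (h21 : ∀ u ∈ U, M.Z21 u ∈ U) :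
    M.IsKStable U := by
  refine isKStable_of_generators hC h0 (fun u hu => ?_) (fun u hu => ?_)
  · have : M.ρ W1 u = (1 / 2 : ℂ) • (M.Z12 u + M.Z21 u) := by
      simp only [Z12, Z21, LinearMap.add_apply, LinearMap.sub_apply, LinearMap.smul_apply]
      module
    rw [this]
    exact U.smul_mem _ (U.add_mem (h12 u hu) (h21 u hu))
  · have : M.ρ W2 u = (I / 2 : ℂ) • (M.Z12 u - M.Z21 u) := by
      simp only [Z12, Z21, LinearMap.add_apply, LinearMap.sub_apply, LinearMap.smul_apply]
      match_scalars
      · linear_combination Complex.I_mul_I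
      · ring
    rw [this]
    exact U.smul_mem _ (U.sub_mem (h12 u hu) (h21 u hu))

theorem IsKStable.iSup {ι : Sort*} {U : ι → Submodule ℂ V} (h : ∀ i, M.IsKStable (U i)) :
    M.IsKStable (⨆ i, U i) := by
  intro Y hY
  have : ⨆ i, U i ≤ (⨆ i, U i).comap (M.ρ Y) :=
    iSup_le fun i u hu => Submodule.mem_iSup_of_mem i (h i Y hY u hu)
  exact fun u hu => this hu

variable (M) in
theorem kSpan_isKStable (S : Submodule ℂ V) : M.IsKStable (M.kSpan S) := by
  intro Y hY u hu
  rw [kSpan, Submodule.mem_sInf] at hu ⊢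
  exact fun U hU => hU.2 Y hY u (hu U hU)

variable (M) in
theorem le_kSpan (S : Submodule ℂ V) : S ≤ M.kSpan S := le_sInf fun _ hU => hU.1

theorem kSpan_le {S U : Submodule ℂ V} (h : S ≤ U) (hU : M.IsKStable U) : M.kSpan S ≤ U :=
  sInf_le ⟨h, hU⟩

/-! ### Isotypic parts and centrality of `C_K` in U(𝔨) -/

theorem mem_isotypic_iff {h : ℤ} {p : ℕ} {x : V} : x ∈ M.isotypic h p ↔
    M.ρ CKi x = -(I * (h : ℂ)) • x ∧ M.casimirK x = -((p : ℂ) * (p + 2)) • x := by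
  simp [isotypic, add_eq_zero_iff_eq_neg]

theorem casimirK_apply (v : V) : M.casimirK v =
    M.ρ W0 (M.ρ W0 v) - (2 * I) • M.ρ W0 v + M.Z12 (M.Z21 v) := by
  simp [casimirK_eq]

theorem CKi_W0 (v : V) : M.ρ CKi (M.ρ W0 v) = M.ρ W0 (M.ρ CKi v) := by
  rw [M.actsAs_CKi.apply_apply M.actsAs_W0 M.actsAs_zero]
  · simp
  · ext i j
    fin_cases i <;> fin_cases j <;> simp [Matrix.mul_apply, Fin.sum_univ_three]

theorem casimirK_CKi (v : V) : M.casimirK (M.ρ CKi v) = M.ρ CKi (M.casimirK v) := by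
  simp only [casimirK_apply, map_sub, map_add, map_smul, CKi_W0, CKi_Z12, CKi_Z21]

theorem casimirK_W0 (v : V) : M.casimirK (M.ρ W0 v) = M.ρ W0 (M.casimirK v) := by
  simp only [casimirK_apply, map_sub, map_add, map_smul, W0_Z12, W0_Z21]
  module

theorem casimirK_Z12 (v : V) : M.casimirK (M.Z12 v) = M.Z12 (M.casimirK v) := by
  have h : M.Z21 (M.Z12 v) = M.Z12 (M.Z21 v) - (4 * I) • M.ρ W0 v := by rw [Z12_Z21]; module
  simp only [casimirK_apply, map_sub, map_add, map_smul, W0_Z12, h]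
  match_scalars <;> ring_nf

theorem casimirK_Z21 (v : V) : M.casimirK (M.Z21 v) = M.Z21 (M.casimirK v) := by
  have h (w) : M.Z21 (M.Z12 w) = M.Z12 (M.Z21 w) - (4 * I) • M.ρ W0 w := by rw [Z12_Z21]; module
  simp only [casimirK_apply, map_sub, map_add, map_smul, W0_Z21, h]
  match_scalars <;> ring_nf

variable (M) in
theorem isotypic_isKStable (h : ℤ) (p : ℕ) : M.IsKStable (M.isotypic h p) := by
  apply isKStable_of_Z <;> intro u hu <;> rw [mem_isotypic_iff] at hu ⊢
  · rw [casimirK_CKi, hu.1, hu.2]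
    simp [hu.1, hu.2]
  · rw [casimirK_W0, CKi_W0, hu.1, hu.2]
    simp
  · rw [casimirK_Z12, CKi_Z12, hu.1, hu.2]
    simp
  · rw [casimirK_Z21, CKi_Z21, hu.1, hu.2]
    simp

/-- The scalar by which `CK_i + C_K` acts in the `K`-type `τ^h_p`. -/
def typeValue (h : ℤ) (p : ℕ) : ℂ := -(I * (h : ℂ)) - (p : ℂ) * (p + 2)

/-- The imaginary part gives `h`, and the real part gives `p(p+2)`, which is strictly increasing on
ℕ. So the single operator CK_i + C_K separates all K-types. -/
theorem typeValue_inj {h h' : ℤ} {p p' : ℕ} (e : typeValue h p = typeValue h' p') :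
    h = h' ∧ p = p' := by
  have h1 := congrArg Complex.im e
  have h2 := congrArg Complex.re e
  simp [typeValue] at h1 h2
  refine ⟨h1, ?_⟩
  have h3 : p * (p + 2) = p' * (p' + 2) := by exact_mod_cast h2
  rcases lt_trichotomy p p' with h | h | h
  · nlinarith
  · exact h
  · nlinarith

theorem isotypic_le_eigenspace (h : ℤ) (p : ℕ) :
    M.isotypic h p ≤ (M.ρ CKi + M.casimirK).eigenspace (typeValue h p) := by
  intro x hx
  rw [mem_isotypic_iff] at hx
  rw [Module.End.mem_eigenspace_iff, LinearMap.add_apply, hx.1, hx.2, typeValue]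
  module

theorem weightSpace_le_isotypic (h : ℤ) (p : ℕ) (q : ℤ) : M.weightSpace h p q ≤ M.isotypic h p :=
  inf_le_left

/-! ### The submodule generated by a minimal vector -/

variable (M) in
/-- The sum of the subspaces `U(𝔨) Z₃₁^a Z₂₃^b x`. -/
def minimalSpan (x : V) : Submodule ℂ V :=
  ⨆ ab : ℕ × ℕ, M.kSpan (ℂ ∙ (M.Z31 ^ ab.1 * M.Z23 ^ ab.2) x)

variable (M) in
theorem minimalSpan_isKStable (x : V) : M.IsKStable (M.minimalSpan x) :=
  IsKStable.iSup fun _ => M.kSpan_isKStable _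

theorem pow_mem_minimalSpan (x : V) (a b : ℕ) :
    (M.Z31 ^ a * M.Z23 ^ b) x ∈ M.minimalSpan x :=
  Submodule.mem_iSup_of_mem (a, b) (M.le_kSpan _ (Submodule.mem_span_singleton_self _))

theorem self_mem_minimalSpan (x : V) : x ∈ M.minimalSpan x := by
  simpa using pow_mem_minimalSpan (M := M) x 0 0

/-- Z₃₂ is the downward shift minus a multiple of Z₁₂Z₃₁: the shift returns to the preceding vector
(or gives 0 if `b = 0`), and Z₁₂ preserves each U(𝔨)-summand. -/
theorem IsHighest.z32_pow_mem {h : ℤ} {p : ℕ} {x : V} (hx : M.IsHighest h p x) {μ : ℂ}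
    (hμ : ∀ v, M.casimir v = μ • v) (hp : M.shiftDownPlus p x = 0)
    (hm : M.shiftDownMinus p x = 0) (a b : ℕ) :
    M.Z32 ((M.Z31 ^ a * M.Z23 ^ b) x) ∈ M.minimalSpan x := by
  have h1 : M.shiftDownPlus (p + a + b) ((M.Z31 ^ a * M.Z23 ^ b) x) ∈ M.minimalSpan x := by
    cases b with
    | zero => simp [shiftDownPlus_Z31_pow hp a]
    | succ b =>
      obtain ⟨⟨c, hc⟩, -⟩ := hx.shiftDown_pow hμ hp hm a b
      rw [hc]
      exact Submodule.smul_mem _ _ (pow_mem_minimalSpan x a b)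
  rw [shiftDownPlus, LinearMap.add_apply, LinearMap.smul_apply,
    Module.End.mul_apply M.Z12] at h1
  refine (Submodule.add_mem_iff_left _ (Submodule.smul_mem _ _ ?_)).mp h1
  apply (M.minimalSpan_isKStable x).z12
  rw [z31_pow]
  exact pow_mem_minimalSpan x _ _

theorem IsHighest.z13_pow_mem {h : ℤ} {p : ℕ} {x : V} (hx : M.IsHighest h p x) {μ : ℂ}
    (hμ : ∀ v, M.casimir v = μ • v) (hp : M.shiftDownPlus p x = 0)
    (hm : M.shiftDownMinus p x = 0) (a b : ℕ) :
    M.Z13 ((M.Z31 ^ a * M.Z23 ^ b) x) ∈ M.minimalSpan x := by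
  have h1 : M.shiftDownMinus (p + a + b) ((M.Z31 ^ a * M.Z23 ^ b) x) ∈ M.minimalSpan x := by
    cases a with
    | zero => simp [shiftDownMinus_Z23_pow hm b]
    | succ a =>
      obtain ⟨-, c, hc⟩ := hx.shiftDown_pow hμ hp hm a b
      rw [hc]
      exact Submodule.smul_mem _ _ (pow_mem_minimalSpan x a b)
  rw [shiftDownMinus, LinearMap.sub_apply, LinearMap.smul_apply,
    Module.End.mul_apply M.Z12] at h1
  refine (Submodule.sub_mem_iff_left _ (Submodule.smul_mem _ _ ?_)).mp h1
  apply (M.minimalSpan_isKStable x).z12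
  rw [hx.z23_pow]
  exact pow_mem_minimalSpan x _ _

theorem IsHighest.rho_mem_minimalSpan {h : ℤ} {p : ℕ} {x : V} (hx : M.IsHighest h p x) {μ : ℂ}
    (hμ : ∀ v, M.casimir v = μ • v) (hp : M.shiftDownPlus p x = 0)
    (hm : M.shiftDownMinus p x = 0) (X : 𝔤) {u : V} (hu : u ∈ M.minimalSpan x) :
    M.ρ X u ∈ M.minimalSpan x := by
  have hk := M.minimalSpan_isKStable x
  -- `U` collects the vectors that all of 𝔤 sends into the span. The bracket relation makes it
  -- 𝔨-stable, so only the generating vectors need checking.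
  let U : Submodule ℂ V := ⨅ X : 𝔤, (M.minimalSpan x).comap (M.ρ X)
  have hU (v) : v ∈ U ↔ ∀ X, M.ρ X v ∈ M.minimalSpan x := by simp [U]
  suffices M.minimalSpan x ≤ U from (hU u).mp (this hu) X
  refine iSup_le fun ab => kSpan_le ?_ ?_
  · rw [Submodule.span_singleton_le_iff_mem, hU]
    intro X
    rw [rho_eq]
    have hy := pow_mem_minimalSpan (M := M) x ab.1 ab.2
    simp only [LinearMap.add_apply, LinearMap.sub_apply, LinearMap.smul_apply]
    refine sub_mem (sub_mem (add_mem (add_mem (add_mem (add_mem (sub_mem ?_ ?_) ?_) ?_) ?_) ?_) ?_)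
      ?_ <;> apply Submodule.smul_mem
    · exact hk.z12 hy
    · exact hk.z21 hy
    · exact hx.z13_pow_mem hμ hp hm _ _
    · rw [z31_pow]
      exact pow_mem_minimalSpan x _ _
    · rw [hx.z23_pow]
      exact pow_mem_minimalSpan x _ _
    · exact hx.z32_pow_mem hμ hp hm _ _
    · exact hk _ cki_mem _ hy
    · exact hk _ w0_mem _ hy
  · intro Y hY v hv
    rw [hU] at hv ⊢
    intro X
    have : M.ρ X (M.ρ Y v) = M.ρ Y (M.ρ X v) + M.ρ ⁅X, Y⁆ v := by
      rw [LieHom.map_lie, Ring.lie_def]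
      simp
    rw [this]
    exact add_mem (hk Y hY _ (hv X)) (hv _)

/-! ### The 𝔰𝔩₂-string Z₁₂^n x below a highest weight vector -/

theorem IsHighest.w0_z12_pow {h : ℤ} {p : ℕ} {x : V} (hx : M.IsHighest h p x) (n : ℕ) :
    M.ρ W0 ((M.Z12 ^ n) x) = (I * (2 * n - p)) • (M.Z12 ^ n) x := by
  induction n with
  | zero => simp [hx.w0]
  | succ n ih =>
    rw [pow_succ', Module.End.mul_apply, W0_Z12, ih, map_smul]
    push_cast
    module

theorem IsHighest.cki_z12_pow {h : ℤ} {p : ℕ} {x : V} (hx : M.IsHighest h p x) (n : ℕ) :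
    M.ρ CKi ((M.Z12 ^ n) x) = (-(I * (h : ℂ))) • (M.Z12 ^ n) x := by
  induction n with
  | zero => simp [hx.cki]
  | succ n ih => rw [pow_succ', Module.End.mul_apply, CKi_Z12, ih, map_smul]

theorem IsHighest.z21_z12_pow {h : ℤ} {p : ℕ} {x : V} (hx : M.IsHighest h p x) (n : ℕ) :
    ∃ c : ℂ, M.Z21 ((M.Z12 ^ (n + 1)) x) = c • (M.Z12 ^ n) x := by
  have h21 (w) : M.Z21 (M.Z12 w) = M.Z12 (M.Z21 w) - (4 * I) • M.ρ W0 w := by rw [Z12_Z21]; module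
  induction n with
  | zero => exact ⟨-(4 * I * (-(I * (p : ℂ)))), by simp [h21, hx.z21, hx.w0, smul_smul]⟩
  | succ n ih =>
    obtain ⟨c, hc⟩ := ih
    refine ⟨c - 4 * I * (I * (2 * (n + 1 : ℕ) - p)), ?_⟩
    rw [pow_succ', Module.End.mul_apply, h21, hc, map_smul, hx.w0_z12_pow, pow_succ',
      Module.End.mul_apply]
    module

theorem IsHighest.kSpan_le {h : ℤ} {p : ℕ} {x : V} (hx : M.IsHighest h p x) :
    M.kSpan (ℂ ∙ x) ≤ ⨆ n : ℕ, ℂ ∙ (M.Z12 ^ n) x := by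
  have hmem (n : ℕ) : (M.Z12 ^ n) x ∈ ⨆ n : ℕ, ℂ ∙ (M.Z12 ^ n) x :=
    Submodule.mem_iSup_of_mem n (Submodule.mem_span_singleton_self _)
  have key (T : Module.End ℂ V) (hT : ∀ n, T ((M.Z12 ^ n) x) ∈ ⨆ n : ℕ, ℂ ∙ (M.Z12 ^ n) x) :
      ∀ u ∈ ⨆ n : ℕ, ℂ ∙ (M.Z12 ^ n) x, T u ∈ ⨆ n : ℕ, ℂ ∙ (M.Z12 ^ n) x := by
    have : ⨆ n : ℕ, ℂ ∙ (M.Z12 ^ n) x ≤ (⨆ n : ℕ, ℂ ∙ (M.Z12 ^ n) x).comap T :=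
      iSup_le fun n => by rw [Submodule.span_singleton_le_iff_mem]; exact hT n
    exact fun u hu => this hu
  refine GKModule.kSpan_le ?_ (isKStable_of_Z (key _ ?_) (key _ ?_) (key _ ?_) (key _ ?_))
  · rw [Submodule.span_singleton_le_iff_mem]
    simpa using hmem 0
  · intro n
    rw [hx.cki_z12_pow]
    exact Submodule.smul_mem _ _ (hmem n)
  · intro n
    rw [hx.w0_z12_pow]
    exact Submodule.smul_mem _ _ (hmem n)
  · intro n
    rw [← Module.End.mul_apply, ← pow_succ']
    exact hmem _
  · intro n
    cases n with
    | zero => simp [hx.z21]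
    | succ n =>
      obtain ⟨c, hc⟩ := hx.z21_z12_pow n
      rw [hc]
      exact Submodule.smul_mem _ _ (hmem n)

theorem IsHighest.kSpan_le_isotypic {h : ℤ} {p : ℕ} {x : V} (hx : M.IsHighest h p x) :
    M.kSpan (ℂ ∙ x) ≤ M.isotypic h p := by
  refine GKModule.kSpan_le ?_ (M.isotypic_isKStable h p)
  rw [Submodule.span_singleton_le_iff_mem]
  exact weightSpace_le_isotypic _ _ _ hx.mem_weightSpace

/-- The summand for `(a, b)` has type `(h + 3(a - b), p + a + b)`, so only `a = b = 0` has the type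
of `x`; within its string, only `n = 0` has the W₀-weight of `x`. -/
theorem IsHighest.minimalSpan_inf_weightSpace {h : ℤ} {p : ℕ} {x v : V} (hx : M.IsHighest h p x)
    (hv : v ∈ M.minimalSpan x) (hw : v ∈ M.weightSpace h p p) : v ∈ ℂ ∙ x := by
  have h1 := mem_iSup_of_mem_eigenspace
    (fun ab : ℕ × ℕ => (hx.pow ab.1 ab.2).kSpan_le_isotypic.trans (isotypic_le_eigenspace _ _))
    hv (isotypic_le_eigenspace _ _ (weightSpace_le_isotypic _ _ _ hw))
  have h2 : v ∈ M.kSpan (ℂ ∙ x) := by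
    refine (iSup₂_le fun ab hab => ?_ : _ ≤ M.kSpan (ℂ ∙ x)) h1
    obtain ⟨-, h3⟩ := typeValue_inj hab
    have ha : ab.1 = 0 := by omega
    have hb : ab.2 = 0 := by omega
    simp [ha, hb]
  have h3 := mem_iSup_of_mem_eigenspace (T := M.ρ W0) (l := fun n : ℕ => I * (2 * (n : ℂ) - p))
    (ν := -(I * (p : ℂ)))
    (fun n => by
      rw [Submodule.span_singleton_le_iff_mem, Module.End.mem_eigenspace_iff, hx.w0_z12_pow])
    (hx.kSpan_le h2) (by
      rw [Module.End.mem_eigenspace_iff]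
      simpa using (M.mem_weightSpace_iff.mp hw).2.2)
  refine (iSup₂_le fun n hn => ?_ : _ ≤ ℂ ∙ x) h3
  have hn' : (n : ℂ) = 0 := by
    have : I * n = 0 := by linear_combination hn / 2
    exact (mul_eq_zero.mp this).resolve_left Complex.I_ne_zero
  have : n = 0 := by exact_mod_cast hn'
  simp [this]

end GKModule

/-! ### One-parameter subgroups of `K` -/

theorem det_km (η α β : ℂ) (hη : ‖η‖ = 1) (h : ‖α‖ ^ 2 + ‖β‖ ^ 2 = 1) : (km η α β).det = 1 := by
  have hη' : η ≠ 0 := by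
    rintro rfl
    simp at hη
  have hc : α * (starRingEnd ℂ) α + β * (starRingEnd ℂ) β = 1 := by
    rw [Complex.mul_conj, Complex.mul_conj, Complex.normSq_eq_norm_sq, Complex.normSq_eq_norm_sq]
    exact_mod_cast h
  rw [Matrix.det_fin_three]
  simp [km]
  field_simp
  linear_combination hc

theorem km_mem (η α β : ℂ) (hη : ‖η‖ = 1) (h : ‖α‖ ^ 2 + ‖β‖ ^ 2 = 1) :
    (km η α β)ᴴ * I21 * km η α β = I21 := by
  have hη' : η ≠ 0 := by
    rintro rfl
    simp at hη
  have hc : α * (starRingEnd ℂ) α + β * (starRingEnd ℂ) β = 1 := by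
    rw [Complex.mul_conj, Complex.mul_conj, Complex.normSq_eq_norm_sq, Complex.normSq_eq_norm_sq]
    exact_mod_cast h
  have hn : η * (starRingEnd ℂ) η = 1 := by
    rw [Complex.mul_conj, Complex.normSq_eq_norm_sq, hη]
    simp
  have hn' : (starRingEnd ℂ) η ≠ 0 := by simpa using hη'
  ext i j
  fin_cases i <;> fin_cases j <;> simp [km, I21, Matrix.mul_apply, Fin.sum_univ_three]
  · linear_combination (η * (starRingEnd ℂ) η) * hc + hn
  · ring
  · ring
  · linear_combination (η * (starRingEnd ℂ) η) * hc + hn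
  · field_simp
    linear_combination (-(η * (starRingEnd ℂ) η) - 1) * hn

/-- The element `k(η, α, β)` of `K`. -/
def kElem (η α β : ℂ) (hη : ‖η‖ = 1) (h : ‖α‖ ^ 2 + ‖β‖ ^ 2 = 1) : K :=
  ⟨⟨⟨km η α β, det_km η α β hη h⟩, km_mem η α β hη h⟩, η, α, β, hη, h, rfl⟩

theorem mat_kElem (η α β : ℂ) (hη : ‖η‖ = 1) (h : ‖α‖ ^ 2 + ‖β‖ ^ 2 = 1) :
    G.mat (kElem η α β hη h) = km η α β := rfl

theorem K.ext_mat {k k' : K} (h : G.mat k = G.mat k') : k = k' :=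
  Subtype.ext (Subtype.ext (Subtype.ext h))

/-- `exp (t CK_i)`. -/
def expCKi (t : ℝ) : K := kElem (Complex.exp (t * I)) 1 0 (Complex.norm_exp_ofReal_mul_I t) (by simp)

/-- `exp (t W₀)`. -/
def expW0 (t : ℝ) : K := kElem 1 (Complex.exp (t * I)) 0 (by simp)
  (by simp [Complex.norm_exp_ofReal_mul_I])

/-- `exp (t W₁)`. -/
def expW1 (t : ℝ) : K := kElem 1 (Real.cos t) (Real.sin t) (by simp)
  (by simp only [Complex.norm_real, Real.norm_eq_abs, sq_abs, Real.cos_sq_add_sin_sq])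

theorem mat_expCKi (t : ℝ) : G.mat (expCKi t) =
    NormedSpace.exp (t • (CKi : Matrix (Fin 3) (Fin 3) ℂ)) := by
  have h : t • (CKi : Matrix (Fin 3) (Fin 3) ℂ) =
      diagonal ![(t : ℂ) * I, t * I, -2 * (t * I)] := by
    ext i j
    fin_cases i <;> fin_cases j <;> simp [CKi]
    ring
  rw [h, Matrix.exp_diagonal, expCKi, mat_kElem]
  ext i j
  fin_cases i <;> fin_cases j <;> simp [km, Pi.coe_exp, ← Complex.exp_eq_exp_ℂ, ← Complex.exp_conj]
  rw [← Complex.exp_nat_mul, ← Complex.exp_neg]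
  simp

theorem exp_smul_W0 (t : ℝ) : NormedSpace.exp (t • (W0 : Matrix (Fin 3) (Fin 3) ℂ)) =
    diagonal ![Complex.exp (t * I), Complex.exp (-(t * I)), 1] := by
  have h : t • (W0 : Matrix (Fin 3) (Fin 3) ℂ) = diagonal ![(t : ℂ) * I, -(t * I), 0] := by
    ext i j
    fin_cases i <;> fin_cases j <;> simp [W0]
  rw [h, Matrix.exp_diagonal]
  congr 1
  ext i
  fin_cases i <;> simp [Pi.coe_exp, ← Complex.exp_eq_exp_ℂ]

theorem mat_expW0 (t : ℝ) : G.mat (expW0 t) =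
    NormedSpace.exp (t • (W0 : Matrix (Fin 3) (Fin 3) ℂ)) := by
  rw [exp_smul_W0, expW0, mat_kElem]
  ext i j
  fin_cases i <;> fin_cases j <;> simp [km, ← Complex.exp_conj]

theorem mat_expW1 (t : ℝ) : G.mat (expW1 t) =
    NormedSpace.exp (t • (W1 : Matrix (Fin 3) (Fin 3) ℂ)) := by
  -- The columns are eigenvectors of W₁ for i, -i, 0, so conjugation reduces to the diagonal matrix
  -- W₀.
  let U : (Matrix (Fin 3) (Fin 3) ℂ)ˣ :=
    ⟨!![1, 1, 0; I, -I, 0; 0, 0, 1], !![1 / 2, -I / 2, 0; 1 / 2, I / 2, 0; 0, 0, 1],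
      by
        ext i j
        fin_cases i <;> fin_cases j <;> simp [Matrix.mul_apply, Fin.sum_univ_three] <;>
          ring_nf <;> simp,
      by
        ext i j
        fin_cases i <;> fin_cases j <;> simp [Matrix.mul_apply, Fin.sum_univ_three] <;>
          ring_nf <;> simp <;> norm_num⟩
  have h : t • (W1 : Matrix (Fin 3) (Fin 3) ℂ) =
      U * (t • (W0 : Matrix (Fin 3) (Fin 3) ℂ)) * (U⁻¹ : (Matrix (Fin 3) (Fin 3) ℂ)ˣ) := by
    ext i j
    fin_cases i <;> fin_cases j <;>
      simp [U, W0, W1, Matrix.mul_apply, Fin.sum_univ_three] <;> ring_nf <;> simp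
  rw [h, Matrix.exp_units_conj, exp_smul_W0, expW1, mat_kElem]
  have hc : (Real.cos t : ℂ) = (Complex.exp (t * I) + Complex.exp (-(t * I))) / 2 := by
    rw [Complex.ofReal_cos, Complex.cos, neg_mul]
  have hs : (Real.sin t : ℂ) = (Complex.exp (-(t * I)) - Complex.exp (t * I)) * I / 2 := by
    rw [Complex.ofReal_sin, Complex.sin, neg_mul]
  rw [km, Complex.conj_ofReal, Complex.conj_ofReal, hc, hs]
  ext i j
  fin_cases i <;> fin_cases j <;>
    simp [U, Matrix.mul_apply, Fin.sum_univ_three, Matrix.vecMul_diagonal] <;> ring_nf <;>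
    (try simp) <;> (try ring)

/-- Euler angles: SU(2) is covered by products of a diagonal element, a real rotation and a diagonal
element; CK_i supplies the central phase `η`. -/
theorem exists_exp (k : K) : ∃ r s t u : ℝ, k = expCKi r * (expW0 s * (expW1 t * expW0 u)) := by
  obtain ⟨η, α, β, hη, h, hk⟩ := k.2
  obtain ⟨t, ht⟩ : ∃ t : ℝ, ‖α‖ = Real.cos t ∧ ‖β‖ = Real.sin t := by
    refine ⟨Complex.arg (⟨‖α‖, ‖β‖⟩), ?_⟩
    have hz : ‖(⟨‖α‖, ‖β‖⟩ : ℂ)‖ = 1 := by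
      rw [← sq_eq_sq₀ (norm_nonneg _) zero_le_one, ← Complex.normSq_eq_norm_sq,
        Complex.normSq_apply]
      linarith
    have h0 : (⟨‖α‖, ‖β‖⟩ : ℂ) ≠ 0 := by
      intro h
      simp [h] at hz
    rw [Complex.cos_arg h0, Complex.sin_arg, hz]
    simp
  -- The product has α = e^{i(s+u)} cos t and β = e^{i(s-u)} sin t, which determines `s` and `u` as
  -- half sum and half difference of the arguments.
  refine ⟨Complex.arg η, (Complex.arg α + Complex.arg β) / 2, t,
    (Complex.arg α - Complex.arg β) / 2, K.ext_mat ?_⟩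
  have e1 := Complex.norm_mul_exp_arg_mul_I η
  have e2 := Complex.norm_mul_exp_arg_mul_I α
  have e3 := Complex.norm_mul_exp_arg_mul_I β
  rw [hη, Complex.ofReal_one, one_mul] at e1
  rw [ht.1] at e2
  rw [ht.2] at e3
  have : G.mat (expCKi (Complex.arg η) * (expW0 ((Complex.arg α + Complex.arg β) / 2) *
      (expW1 t * expW0 ((Complex.arg α - Complex.arg β) / 2))) : K) =
    G.mat (expCKi (Complex.arg η)) * (G.mat (expW0 ((Complex.arg α + Complex.arg β) / 2)) *
      (G.mat (expW1 t) * G.mat (expW0 ((Complex.arg α - Complex.arg β) / 2)))) := rfl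
  rw [this, hk, expCKi, expW0, expW1, expW0]
  simp only [mat_kElem, km_mul]
  congr 1
  · simp [e1]
  · refine e2.symm.trans ?_
    simp only [map_zero, mul_zero, sub_zero, zero_mul, one_mul]
    rw [mul_left_comm, ← Complex.exp_add]
    push_cast
    ring_nf
  · refine e3.symm.trans ?_
    simp only [map_zero, mul_zero, zero_mul, one_mul, add_zero, zero_add, ← Complex.exp_conj]
    rw [mul_left_comm, ← Complex.exp_add]
    simp only [map_mul, Complex.conj_ofReal, Complex.conj_I]
    push_cast
    ring_nf

namespace GKModule

variable {V : Type*} [AddCommGroup V] [Module ℂ V] (M : GKModule V)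

/-! ### Subspaces that are stable under `𝔤` are stable under `K` -/

/-- The span of the `K`-orbit of `v`. -/
def orbitSpan (v : V) : Submodule ℂ V := Submodule.span ℂ (Set.range fun k : K => M.π k v)

instance (v : V) : FiniteDimensional ℂ (M.orbitSpan v) := M.finite v

variable {M}

theorem pi_mem_orbitSpan (v : V) (k : K) : M.π k v ∈ M.orbitSpan v :=
  Submodule.subset_span ⟨k, rfl⟩

theorem self_mem_orbitSpan (v : V) : v ∈ M.orbitSpan v := by
  simpa using pi_mem_orbitSpan (M := M) v 1

theorem orbitSpan_pi_mem {v w : V} (hw : w ∈ M.orbitSpan v) (k : K) : M.π k w ∈ M.orbitSpan v := by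
  have : M.orbitSpan v ≤ (M.orbitSpan v).comap (M.π k) := by
    refine Submodule.span_le.mpr ?_
    rintro _ ⟨k', rfl⟩
    rw [SetLike.mem_coe, Submodule.mem_comap, ← Module.End.mul_apply, ← map_mul]
    exact pi_mem_orbitSpan v _
  exact this hw

/-- A functional vanishing on the orbit span vanishes along the curve through `w`, hence on its
derivative ρ(Y)w. -/
theorem orbitSpan_rho_mem {Y : 𝔤} {c : ℝ → K}
    (hc : ∀ t : ℝ, G.mat (c t) = NormedSpace.exp (t • (Y : Matrix (Fin 3) (Fin 3) ℂ)))
    {v w : V} (hw : w ∈ M.orbitSpan v) : M.ρ Y w ∈ M.orbitSpan v := by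
  by_contra h
  obtain ⟨φ, hφ, hle⟩ := Submodule.exists_le_ker_of_notMem h
  have h0 : (fun t : ℝ => φ (M.π (c t) w)) = fun _ => 0 :=
    funext fun t => hle (orbitSpan_pi_mem hw (c t))
  have h1 := M.hasDerivAt Y c hc w φ
  rw [h0] at h1
  exact hφ (h1.unique (hasDerivAt_const 0 0))

theorem orbitSpan_isKStable (v : V) : M.IsKStable (M.orbitSpan v) := by
  have h0 (u) (hu : u ∈ M.orbitSpan v) := orbitSpan_rho_mem (M := M) mat_expW0 hu
  have h1 (u) (hu : u ∈ M.orbitSpan v) := orbitSpan_rho_mem (M := M) mat_expW1 hu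
  refine isKStable_of_generators (fun u hu => orbitSpan_rho_mem mat_expCKi hu) h0 h1 ?_
  intro u hu
  -- Writing W₂ as a bracket avoids computing a further one-parameter subgroup.
  have h : W2 = (1 / 2 : ℝ) • ⁅W0, W1⁆ := by
    apply Subtype.ext
    ext i j
    fin_cases i <;> fin_cases j <;>
      simp [W0, W1, W2, Ring.lie_def, Matrix.mul_apply, Fin.sum_univ_three] <;> ring
  rw [h, map_smul, ← Complex.coe_smul, LieHom.map_lie, Ring.lie_def]
  exact Submodule.smul_mem _ _ (sub_mem (h0 _ (h1 _ hu)) (h1 _ (h0 _ hu)))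

theorem curve_add {Y : 𝔤} {c : ℝ → K}
    (hc : ∀ t : ℝ, G.mat (c t) = NormedSpace.exp (t • (Y : Matrix (Fin 3) (Fin 3) ℂ)))
    (s t : ℝ) : c (s + t) = c s * c t := by
  apply K.ext_mat
  change _ = G.mat (c s) * G.mat (c t)
  rw [hc, hc, hc, add_smul, Matrix.exp_add_of_commute]
  exact ((Commute.refl _).smul_left s).smul_right t

theorem hasDerivAt_pi_curve {Y : 𝔤} {c : ℝ → K}
    (hc : ∀ t : ℝ, G.mat (c t) = NormedSpace.exp (t • (Y : Matrix (Fin 3) (Fin 3) ℂ)))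
    (v : V) (φ : Module.Dual ℂ V) (t : ℝ) :
    HasDerivAt (fun t : ℝ => φ (M.π (c t) v)) (φ (M.ρ Y (M.π (c t) v))) t := by
  have h := M.hasDerivAt Y c hc (M.π (c t) v) φ
  rw [← sub_self t] at h
  have h' := h.comp_sub_const t t
  have e : (fun s : ℝ => φ (M.π (c (s - t)) (M.π (c t) v))) = fun s => φ (M.π (c s) v) := by
    funext s
    rw [← Module.End.mul_apply, ← map_mul, ← curve_add hc, sub_add_cancel]
  rwa [e] at h'

/-- Modulo `U`, the curve π(c t)u stays in a finite-dimensional space. Its coordinates there solve a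
linear ODE with initial value 0, so they vanish identically. -/
theorem pi_curve_mem {Y : 𝔤} {c : ℝ → K}
    (hc : ∀ t : ℝ, G.mat (c t) = NormedSpace.exp (t • (Y : Matrix (Fin 3) (Fin 3) ℂ)))
    {U : Submodule ℂ V} (hU : ∀ u ∈ U, M.ρ Y u ∈ U) {u : V} (hu : u ∈ U) (t : ℝ) :
    M.π (c t) u ∈ U := by
  let E := M.orbitSpan u
  let E' : Submodule ℂ (V ⧸ U) := E.map U.mkQ
  let b := Module.finBasis ℂ E'
  choose ψ hψ using fun i => LinearMap.exists_extend (b.coord i)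
  choose e heE he using fun i => (b i).2
  let φ (i) : Module.Dual ℂ V := ψ i ∘ₗ U.mkQ
  have hφ (w) (hw : w ∈ E) (i) : φ i w = b.repr ⟨U.mkQ w, w, hw, rfl⟩ i :=
    LinearMap.congr_fun (hψ i) ⟨U.mkQ w, w, hw, rfl⟩
  have hφU (w) (hw : w ∈ U) (i) : φ i w = 0 := by
    simp [φ, (Submodule.Quotient.mk_eq_zero U).mpr hw]
  have hmk (w) (hw : w ∈ E) : U.mkQ w = ∑ i, φ i w • U.mkQ (e i) := by
    have h := congrArg Subtype.val (b.sum_repr ⟨U.mkQ w, w, hw, rfl⟩)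
    rw [AddSubmonoidClass.coe_finsetSum] at h
    refine h.symm.trans (Finset.sum_congr rfl fun i _ => ?_)
    rw [hφ w hw, he, Submodule.coe_smul]
  let A : Matrix (Fin (Module.finrank ℂ E')) (Fin (Module.finrank ℂ E')) ℂ :=
    Matrix.of fun i j => φ i (M.ρ Y (e j))
  have hA (w) (hw : w ∈ E) (i) : φ i (M.ρ Y w) = (A *ᵥ fun j => φ j w) i := by
    -- Each `e j` lifts a basis vector of the quotient, so `w` agrees modulo `U` with its coordinate
    -- expansion; stability of `U` under ρ(Y) turns ρ(Y) into the matrix `A`.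
    have h1 : w - ∑ j, φ j w • e j ∈ U := by
      rw [← Submodule.Quotient.mk_eq_zero, ← Submodule.mkQ_apply, map_sub, hmk w hw, sub_eq_zero]
      simp
    have h2 := hφU _ (hU _ h1) i
    rw [map_sub, map_sub, sub_eq_zero] at h2
    rw [h2]
    simp [A, Matrix.mulVec, dotProduct, mul_comm]
  let y : ℝ → Fin (Module.finrank ℂ E') → ℂ := fun t i => φ i (M.π (c t) u)
  have hy (t) : HasDerivAt y (A *ᵥ y t) t := by
    rw [hasDerivAt_pi]
    intro i
    rw [← hA _ (pi_mem_orbitSpan u (c t))]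
    exact hasDerivAt_pi_curve hc u (φ i) t
  have hc0 : c 0 = 1 := by
    have := curve_add hc 0 0
    rwa [add_zero, left_eq_mul] at this
  have h0 : y = fun _ => 0 := by
    refine ODE_solution_unique_univ (t₀ := 0) (v := fun _ x => A *ᵥ x) (s := fun _ => Set.univ)
      (K := ‖(LinearMap.toContinuousLinearMap (Matrix.mulVecLin A))‖₊) (fun t => ?_)
      (fun t => ⟨hy t, trivial⟩) (fun t => ⟨?_, trivial⟩) ?_
    · exact ((LinearMap.toContinuousLinearMap (Matrix.mulVecLin A)).lipschitz).lipschitzOnWith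
    · rw [Matrix.mulVec_zero]
      exact hasDerivAt_const t 0
    · funext i
      simpa [y, hc0] using hφU u hu i
  rw [← Submodule.Quotient.mk_eq_zero, ← Submodule.mkQ_apply, hmk _ (pi_mem_orbitSpan u (c t))]
  refine Finset.sum_eq_zero fun i _ => ?_
  have : φ i (M.π (c t) u) = 0 := congrFun (congrFun h0 t) i
  rw [this, zero_smul]

theorem isInvariant_of_rho_mem {U : Submodule ℂ V} (hU : ∀ X : 𝔤, ∀ u ∈ U, M.ρ X u ∈ U) :
    M.IsInvariant U := by
  refine ⟨hU, fun k u hu => ?_⟩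
  obtain ⟨r, s, t, w, rfl⟩ := exists_exp k
  simp only [map_mul, Module.End.mul_apply]
  exact pi_curve_mem mat_expCKi (hU _) (pi_curve_mem mat_expW0 (hU _)
    (pi_curve_mem mat_expW1 (hU _) (pi_curve_mem mat_expW0 (hU _) hu _) _) _) _

/-! ### Highest weight spaces -/

/-- Otherwise the 𝔰𝔩₂ relations would keep all Z₂₁^(n+1) x nonzero. Having distinct W₀-weights, they
would be infinitely many independent vectors in the finite-dimensional orbit span. -/
theorem z21_eq_zero_of_mem_weightSpace {h : ℤ} {p : ℕ} {x : V} (hx : x ∈ M.weightSpace h p p) :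
    M.Z21 x = 0 := by
  obtain ⟨-, hK, h0⟩ := M.mem_weightSpace_iff.mp hx
  rw [Int.cast_natCast] at h0
  by_contra hne
  have hw (n : ℕ) : M.ρ W0 ((M.Z21 ^ (n + 1)) x) =
      (-(I * (p + 2 * (n + 1)))) • (M.Z21 ^ (n + 1)) x := by
    induction n with
    | zero =>
      rw [zero_add, pow_one, W0_Z21, h0, map_smul]
      push_cast
      module
    | succ n ih =>
      rw [pow_succ', Module.End.mul_apply, W0_Z21, ih, map_smul]
      push_cast
      module
  have h12 (n : ℕ) : M.Z12 ((M.Z21 ^ (n + 2)) x) =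
      ((4 * (n + 1) * (p + 2 + n) : ℕ) : ℂ) • (M.Z21 ^ (n + 1)) x := by
    induction n with
    | zero =>
      -- The eigenvalue -p(p+2) of `C_K` is exactly what the W₀ terms contribute at weight `p`.
      have h12' : M.Z12 (M.Z21 x) = 0 := by
        have := casimirK_apply (M := M) x
        rw [hK, h0, map_smul, h0] at this
        have e : M.Z12 (M.Z21 x) = (-((p : ℂ) * (p + 2)) - (I * p) * (I * p) -
            2 * I * (I * p)) • x := by
          rw [← sub_eq_iff_eq_add'] at this
          rw [← this]
          module
        rw [e]
        have : -((p : ℂ) * (p + 2)) - (I * p) * (I * p) - 2 * I * (I * p) = 0 := by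
          linear_combination (-(p : ℂ) * p - 2 * p) * Complex.I_mul_I
        rw [this, zero_smul]
      have := hw 0
      rw [zero_add, pow_one] at this
      rw [zero_add, zero_add, pow_one, pow_two, Module.End.mul_apply, Z12_Z21, h12', map_zero, this]
      match_scalars
      linear_combination (-4 * ((p : ℂ) + 2)) * Complex.I_mul_I
    | succ n ih =>
      rw [pow_succ', Module.End.mul_apply, Z12_Z21, ih, map_smul, hw, ← Module.End.mul_apply,
        ← pow_succ']
      match_scalars
      linear_combination (-4 * ((p : ℂ) + 2 * (n + 1 + 1))) * Complex.I_mul_I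
  have hn (n : ℕ) : (M.Z21 ^ (n + 1)) x ≠ 0 := by
    induction n with
    | zero => simpa using hne
    | succ n ih =>
      intro h
      have := h12 n
      rw [h, map_zero, eq_comm, smul_eq_zero] at this
      refine this.elim (fun h => ?_) ih
      rw [Nat.cast_eq_zero] at h
      simp at h
  have hE (n : ℕ) : (M.Z21 ^ n) x ∈ M.orbitSpan x := by
    induction n with
    | zero => exact self_mem_orbitSpan x
    | succ n ih =>
      rw [pow_succ', Module.End.mul_apply]
      exact (orbitSpan_isKStable x).z21 ih
  have hli : LinearIndependent ℂ fun n : ℕ => (M.Z21 ^ (n + 1)) x := by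
    refine Module.End.eigenvectors_linearIndependent' (M.ρ W0)
      (fun n : ℕ => -(I * ((p : ℂ) + 2 * (n + 1)))) ?_ _ fun n => ⟨?_, hn n⟩
    · intro m n hmn
      have := mul_left_cancel₀ Complex.I_ne_zero (neg_injective hmn)
      have h' : (m : ℂ) = n := by linear_combination this / 2
      exact_mod_cast h'
    · exact Module.End.mem_eigenspace_iff.mpr (hw n)
  have hli' : LinearIndependent ℂ fun n : ℕ => (⟨(M.Z21 ^ (n + 1)) x, hE _⟩ : M.orbitSpan x) :=
    LinearIndependent.of_comp (M.orbitSpan x).subtype hli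
  exact not_finite_iff_infinite.mpr inferInstance hli'.finite

theorem isHighest_of_mem_weightSpace {h : ℤ} {p : ℕ} {x : V} (hx : x ∈ M.weightSpace h p p) :
    M.IsHighest h p x where
  cki := (M.mem_weightSpace_iff.mp hx).1
  w0 := by simpa using (M.mem_weightSpace_iff.mp hx).2.2
  z21 := z21_eq_zero_of_mem_weightSpace hx

end GKModule

namespace GKModule

universe u v

variable {V : Type u} [AddCommGroup V] [Module ℂ V] {W : Type v} [AddCommGroup W] [Module ℂ W]

/-! ### Direct sums of two modules -/

/-- The direct sum of two `(𝔤, K)`-modules. -/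
def prod (M : GKModule V) (N : GKModule W) : GKModule (V × W) where
  ρ :=
    { toFun := fun X => (M.ρ X).prodMap (N.ρ X)
      map_add' := fun X Y => by ext <;> simp
      map_smul' := fun c X => by ext <;> simp
      map_lie' := fun {X Y} => by ext <;> simp [Ring.lie_def] }
  π :=
    { toFun := fun k => (M.π k).prodMap (N.π k)
      map_one' := by ext <;> simp
      map_mul' := fun k k' => by ext <;> simp }
  compat k X v := Prod.ext (M.compat k X v.1) (N.compat k X v.2)
  finite v := by
    have h1 := Submodule.fg_iff_finiteDimensional _ |>.mpr (M.finite v.1)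
    have h2 := Submodule.fg_iff_finiteDimensional _ |>.mpr (N.finite v.2)
    have := Submodule.fg_iff_finiteDimensional _ |>.mp (h1.prod h2)
    refine Submodule.finiteDimensional_of_le (Submodule.span_le.mpr ?_ :
      _ ≤ (Submodule.span ℂ (Set.range fun k : K => M.π k v.1)).prod
        (Submodule.span ℂ (Set.range fun k : K => N.π k v.2)))
    rintro _ ⟨k, rfl⟩
    exact ⟨Submodule.subset_span ⟨k, rfl⟩, Submodule.subset_span ⟨k, rfl⟩⟩
  continuous v φ := by
    have h : (fun k : K => φ ((M.π k).prodMap (N.π k) v)) =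
        fun k => (φ ∘ₗ LinearMap.inl ℂ V W) (M.π k v.1) +
          (φ ∘ₗ LinearMap.inr ℂ V W) (N.π k v.2) := by
      funext k
      simp [← map_add]
    exact h ▸ (M.continuous v.1 _).add (N.continuous v.2 _)
  hasDerivAt Y c hc v φ := by
    have h (a : V) (b : W) : φ (a, b) = (φ ∘ₗ LinearMap.inl ℂ V W) a +
        (φ ∘ₗ LinearMap.inr ℂ V W) b := by
      simp [← map_add]
    have h' := (M.hasDerivAt Y c hc v.1 (φ ∘ₗ LinearMap.inl ℂ V W)).add
      (N.hasDerivAt Y c hc v.2 (φ ∘ₗ LinearMap.inr ℂ V W))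
    rw [← h] at h'
    refine h'.congr_of_eventuallyEq (Filter.Eventually.of_forall fun t => ?_)
    exact h _ _

variable {M : GKModule V} {N : GKModule W}

theorem prod_rho (X : 𝔤) (v : V × W) : (M.prod N).ρ X v = (M.ρ X v.1, N.ρ X v.2) := rfl

theorem prod_pi (k : K) (v : V × W) : (M.prod N).π k v = (M.π k v.1, N.π k v.2) := rfl

theorem IsHighest.prod {h : ℤ} {p : ℕ} {x : V} {y : W} (hx : M.IsHighest h p x)
    (hy : N.IsHighest h p y) : (M.prod N).IsHighest h p (x, y) where
  cki := Prod.ext hx.cki hy.cki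
  w0 := Prod.ext hx.w0 hy.w0
  z21 := Prod.ext hx.z21 hy.z21

/-- Irreducible `(𝔤, K)`-modules with minimal vectors of the same type and the same Casimir
eigenvalue are isomorphic. -/
theorem isomorphic_of_isMinimal (hM : M.IsIrreducible) (hN : N.IsIrreducible) {μ : ℂ}
    (hμM : ∀ v, M.casimir v = μ • v) (hμN : ∀ w, N.casimir w = μ • w) {h : ℤ} {p : ℕ} {x : V}
    {y : W} (hx : M.IsMinimal h p x) (hy : N.IsMinimal h p y) : M.Isomorphic N := by
  have hxy := (isHighest_of_mem_weightSpace hx.mem).prod (isHighest_of_mem_weightSpace hy.mem)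
  let U := (M.prod N).minimalSpan (x, y)
  have hU : (M.prod N).IsInvariant U := isInvariant_of_rho_mem fun X u hu =>
    hxy.rho_mem_minimalSpan (fun v => Prod.ext (hμM v.1) (hμN v.2))
      (Prod.ext hx.shift_plus hy.shift_plus) (Prod.ext hx.shift_minus hy.shift_minus) X hu
  have hmem : (x, y) ∈ U := self_mem_minimalSpan _
  -- Both projections of `U` are nonzero submodules, since they contain `x` and `y`.
  have hfst : U.map (LinearMap.fst ℂ V W) = ⊤ := by
    refine (hM.2 _ ⟨?_, ?_⟩).resolve_left fun h0 => hx.ne_zero ?_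
    · rintro X _ ⟨u, hu, rfl⟩
      exact ⟨_, hU.1 X u hu, rfl⟩
    · rintro k _ ⟨u, hu, rfl⟩
      exact ⟨_, hU.2 k u hu, rfl⟩
    · exact (Submodule.eq_bot_iff _).mp h0 x ⟨_, hmem, rfl⟩
  have hsnd : U.map (LinearMap.snd ℂ V W) = ⊤ := by
    refine (hN.2 _ ⟨?_, ?_⟩).resolve_left fun h0 => hy.ne_zero ?_
    · rintro X _ ⟨u, hu, rfl⟩
      exact ⟨_, hU.1 X u hu, rfl⟩
    · rintro k _ ⟨u, hu, rfl⟩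
      exact ⟨_, hU.2 k u hu, rfl⟩
    · exact (Submodule.eq_bot_iff _).mp h0 y ⟨_, hmem, rfl⟩
  have hinl : U.comap (LinearMap.inl ℂ V W) = ⊥ := by
    refine (hM.2 _ ⟨?_, ?_⟩).resolve_right fun h1 => ?_
    · intro X u hu
      simpa [prod_rho] using hU.1 X _ hu
    · intro k u hu
      simpa [prod_pi] using hU.2 k _ hu
    · have hx0 : (x, (0 : W)) ∈ U := h1.ge (Submodule.mem_top (x := x))
      -- `(x, 0)` has the type of `(x, y)`; lying in `U`, it would be a multiple of `(x, y)`,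
      -- impossible as `x` and `y` are nonzero.
      have hw : (x, (0 : W)) ∈ (M.prod N).weightSpace h p p :=
        ((isHighest_of_mem_weightSpace hx.mem).prod ⟨by simp, by simp, by simp⟩).mem_weightSpace
      obtain ⟨c, hc⟩ := Submodule.mem_span_singleton.mp (hxy.minimalSpan_inf_weightSpace hx0 hw)
      have hc2 : c • y = 0 := congrArg Prod.snd hc
      have hc1 : c • x = x := congrArg Prod.fst hc
      rw [(smul_eq_zero.mp hc2).resolve_right hy.ne_zero, zero_smul] at hc1
      exact hx.ne_zero hc1.symm
  have hinr : U.comap (LinearMap.inr ℂ V W) = ⊥ := by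
    refine (hN.2 _ ⟨?_, ?_⟩).resolve_right fun h1 => ?_
    · intro X u hu
      simpa [prod_rho] using hU.1 X _ hu
    · intro k u hu
      simpa [prod_pi] using hU.2 k _ hu
    · have hy0 : ((0 : V), y) ∈ U := h1.ge (Submodule.mem_top (x := y))
      have hw : ((0 : V), y) ∈ (M.prod N).weightSpace h p p :=
        (IsHighest.prod ⟨by simp, by simp, by simp⟩
          (isHighest_of_mem_weightSpace hy.mem)).mem_weightSpace
      obtain ⟨c, hc⟩ := Submodule.mem_span_singleton.mp (hxy.minimalSpan_inf_weightSpace hy0 hw)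
      have hc2 : c • y = y := congrArg Prod.snd hc
      have hc1 : c • x = 0 := congrArg Prod.fst hc
      rw [(smul_eq_zero.mp hc1).resolve_right hx.ne_zero, zero_smul] at hc2
      exact hy.ne_zero hc2.symm
  let f : U →ₗ[ℂ] V := LinearMap.fst ℂ V W ∘ₗ U.subtype
  let g : U →ₗ[ℂ] W := LinearMap.snd ℂ V W ∘ₗ U.subtype
  have hf : Function.Bijective f := by
    constructor
    · rw [← LinearMap.ker_eq_bot, Submodule.eq_bot_iff]
      rintro ⟨⟨a, b⟩, hu⟩ (rfl : a = 0)
      have : b ∈ U.comap (LinearMap.inr ℂ V W) := hu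
      rw [hinr, Submodule.mem_bot] at this
      subst this
      rfl
    · intro a
      obtain ⟨u, hu, rfl⟩ := hfst.ge (Submodule.mem_top (x := a))
      exact ⟨⟨u, hu⟩, rfl⟩
  have hg : Function.Bijective g := by
    constructor
    · rw [← LinearMap.ker_eq_bot, Submodule.eq_bot_iff]
      rintro ⟨⟨a, b⟩, hu⟩ (rfl : b = 0)
      have : a ∈ U.comap (LinearMap.inl ℂ V W) := hu
      rw [hinl, Submodule.mem_bot] at this
      subst this
      rfl
    · intro a
      obtain ⟨u, hu, rfl⟩ := hsnd.ge (Submodule.mem_top (x := a))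
      exact ⟨⟨u, hu⟩, rfl⟩
  -- `U` is the graph of `e`, and invariance of the graph is equivariance of `e`.
  let e := (LinearEquiv.ofBijective f hf).symm ≪≫ₗ LinearEquiv.ofBijective g hg
  have he (u : U) : e u.1.1 = u.1.2 := by
    have h1 : (LinearEquiv.ofBijective f hf).symm u.1.1 = u :=
      (LinearEquiv.ofBijective f hf).symm_apply_apply u
    simp only [e, LinearEquiv.trans_apply, h1]
    rfl
  refine ⟨e, fun X v => ?_, fun k v => ?_⟩
  · obtain ⟨u, rfl⟩ := hf.2 v
    exact (he ⟨_, hU.1 X u u.2⟩).trans (congrArg (N.ρ X) (he u).symm)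
  · obtain ⟨u, rfl⟩ := hf.2 v
    exact (he ⟨_, hU.2 k u u.2⟩).trans (congrArg (N.π k) (he u).symm)

/-! ### The parameters of a special module -/

theorem summand_le_isotypic (h : ℤ) (p a b : ℕ) :
    M.summand h p a b ≤ M.isotypic (h + 3 * ((a : ℤ) - b)) (p + a + b) := by
  refine kSpan_le ?_ (M.isotypic_isKStable _ _)
  rintro _ ⟨x, hx, rfl⟩
  exact weightSpace_le_isotypic _ _ _
    ((isHighest_of_mem_weightSpace hx).pow a b).mem_weightSpace

/-- The `K`-types that occur in a special module. -/
theorem IsSpecial.weightSpace_ne_bot_iff {P : ParameterSet} (hP : M.IsSpecial P) (h : ℤ) (p : ℕ) :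
    M.weightSpace h p p ≠ ⊥ ↔ ∃ a b : ℕ, (a : ℕ∞) ≤ P.A ∧ (b : ℕ∞) ≤ P.B ∧
      h = P.h₀ + 3 * ((a : ℤ) - b) ∧ p = P.p₀ + a + b := by
  constructor
  · intro hne
    obtain ⟨v, hv, hv0⟩ := Submodule.exists_mem_ne_zero_of_ne_bot hne
    have htop : v ∈ ⨆ ab : {ab : ℕ × ℕ // (ab.1 : ℕ∞) ≤ P.A ∧ (ab.2 : ℕ∞) ≤ P.B},
        M.summand P.h₀ P.p₀ ab.1.1 ab.1.2 := by
      rw [hP.directSum.submodule_iSup_eq_top]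
      trivial
    have h1 := mem_iSup_of_mem_eigenspace
      (F := fun ab : {ab : ℕ × ℕ // (ab.1 : ℕ∞) ≤ P.A ∧ (ab.2 : ℕ∞) ≤ P.B} =>
        M.summand P.h₀ P.p₀ ab.1.1 ab.1.2)
      (l := fun ab => typeValue (P.h₀ + 3 * ((ab.1.1 : ℤ) - ab.1.2)) (P.p₀ + ab.1.1 + ab.1.2))
      (fun ab => (summand_le_isotypic _ _ _ _).trans (isotypic_le_eigenspace _ _)) htop
      (isotypic_le_eigenspace h p (weightSpace_le_isotypic _ _ _ hv))
    by_contra hno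
    refine hv0 ((Submodule.mem_bot ℂ).mp ((iSup₂_le fun ab hab => ?_ : _ ≤ (⊥ : Submodule ℂ V)) h1))
    obtain ⟨e1, e2⟩ := typeValue_inj hab
    exact (hno ⟨ab.1.1, ab.1.2, ab.2.1, ab.2.2, e1.symm, e2.symm⟩).elim
  · rintro ⟨a, b, ha, hb, rfl, rfl⟩ hbot
    -- If the highest weight space were zero, the generators Z₃₁^a Z₂₃^b x lying in it would vanish,
    -- and the summand with them.
    refine hP.summand_ne_bot a b ha hb ?_
    rw [eq_bot_iff]
    refine kSpan_le ?_ fun Y _ u hu => by simp [(Submodule.mem_bot ℂ).mp hu]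
    rintro _ ⟨x, hx, rfl⟩
    rw [← hbot]
    exact ((isHighest_of_mem_weightSpace hx).pow a b).mem_weightSpace

/-! ### Recovering the parameters from the isomorphism class -/

theorem Isomorphic.weightSpace_ne_bot (hMN : M.Isomorphic N) {h : ℤ} {p : ℕ}
    (hM : M.weightSpace h p p ≠ ⊥) : N.weightSpace h p p ≠ ⊥ := by
  obtain ⟨e, he, -⟩ := hMN
  obtain ⟨v, hv, hv0⟩ := Submodule.exists_mem_ne_zero_of_ne_bot hM
  refine Submodule.ne_bot_iff _ |>.mpr ⟨e v, ?_, by simpa using hv0⟩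
  rw [mem_weightSpace_iff] at hv ⊢
  have hK : N.casimirK (e v) = e (M.casimirK v) := by simp [casimirK, he]
  rw [hK, ← he, ← he, hv.1, hv.2.1, hv.2.2]
  simp only [map_smul, and_self]

theorem Isomorphic.symm (hMN : M.Isomorphic N) : N.Isomorphic M := by
  obtain ⟨e, he, hk⟩ := hMN
  refine ⟨e.symm, fun X w => ?_, fun k w => ?_⟩
  · rw [LinearEquiv.symm_apply_eq, he, e.apply_symm_apply]
  · rw [LinearEquiv.symm_apply_eq, hk, e.apply_symm_apply]

theorem Isomorphic.casimir_eq (hMN : M.Isomorphic N) {P Q : ParameterSet} (hP : M.IsSpecial P)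
    (hQ : N.IsSpecial Q) : P.μ₂ = Q.μ₂ := by
  obtain ⟨e, he, -⟩ := hMN
  obtain ⟨v, hv, -⟩ := hP.generated
  have hc : N.casimir (e v) = e (M.casimir v) := by
    simp [casimir, Z12, Z21, Z13, Z31, Z23, Z32, he]
  rw [hP.casimir_eq, hQ.casimir_eq, map_smul] at hc
  exact (smul_left_injective ℂ (by simpa using hv.ne_zero : e v ≠ 0) hc).symm

/-- On this ray `a - b = n` and `a + b = n`, which forces `b = 0` and `a = n`; so the length of the
ray is `A`. -/
theorem IsSpecial.weightSpace_ray_A {P : ParameterSet} (hP : M.IsSpecial P) (n : ℕ) :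
    M.weightSpace (P.h₀ + 3 * n) (P.p₀ + n) (P.p₀ + n : ℕ) ≠ ⊥ ↔ (n : ℕ∞) ≤ P.A := by
  rw [hP.weightSpace_ne_bot_iff]
  constructor
  · rintro ⟨a, b, ha, hb, h1, h2⟩
    rwa [show n = a by omega]
  · exact fun h => ⟨n, 0, h, by simp, by simp, by simp⟩

theorem IsSpecial.weightSpace_ray_B {P : ParameterSet} (hP : M.IsSpecial P) (n : ℕ) :
    M.weightSpace (P.h₀ - 3 * n) (P.p₀ + n) (P.p₀ + n : ℕ) ≠ ⊥ ↔ (n : ℕ∞) ≤ P.B := by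
  rw [hP.weightSpace_ne_bot_iff]
  constructor
  · rintro ⟨a, b, ha, hb, h1, h2⟩
    rwa [show n = b by omega]
  · exact fun h => ⟨0, n, by simp, h, by simp; ring, by simp⟩

theorem Isomorphic.parameterSet_eq (hMN : M.Isomorphic N) {P Q : ParameterSet}
    (hP : M.IsSpecial P) (hQ : N.IsSpecial Q) : P = Q := by
  have hT (h : ℤ) (p : ℕ) : M.weightSpace h p p ≠ ⊥ ↔ N.weightSpace h p p ≠ ⊥ :=
    ⟨hMN.weightSpace_ne_bot, hMN.symm.weightSpace_ne_bot⟩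
  obtain ⟨a, b, -, -, h1, h2⟩ := (hQ.weightSpace_ne_bot_iff _ _).mp
    ((hT _ _).mp ((hP.weightSpace_ne_bot_iff P.h₀ P.p₀).mpr ⟨0, 0, by simp⟩))
  obtain ⟨a', b', -, -, h1', h2'⟩ := (hP.weightSpace_ne_bot_iff _ _).mp
    ((hT _ _).mpr ((hQ.weightSpace_ne_bot_iff Q.h₀ Q.p₀).mpr ⟨0, 0, by simp⟩))
  -- Each of the two values is at least the other. Then `a + b = 0`, which also gives equality of
  -- the `h₀`.
  have hp : P.p₀ = Q.p₀ := by omega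
  have hh : P.h₀ = Q.h₀ := by omega
  have hA (n : ℕ) : (n : ℕ∞) ≤ P.A ↔ (n : ℕ∞) ≤ Q.A := by
    rw [← hP.weightSpace_ray_A, ← hQ.weightSpace_ray_A, hT, hp, hh]
  have hB (n : ℕ) : (n : ℕ∞) ≤ P.B ↔ (n : ℕ∞) ≤ Q.B := by
    rw [← hP.weightSpace_ray_B, ← hQ.weightSpace_ray_B, hT, hp, hh]
  exact ParameterSet.ext (hMN.casimir_eq hP hQ) hh hp
    (ENat.eq_of_forall_natCast_le_iff hA) (ENat.eq_of_forall_natCast_le_iff hB)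

end GKModule

end SU21

end

theorem mainTheorem7 {V W : Type*} [AddCommGroup V] [Module ℂ V] [AddCommGroup W] [Module ℂ W]
    (M : SU21.GKModule V) (N : SU21.GKModule W)
    (hM : M.IsIrreducible) (hN : N.IsIrreducible)
    (P Q : SU21.ParameterSet) (hP : M.IsSpecial P) (hQ : N.IsSpecial Q) :
    M.Isomorphic N ↔ P = Q := by
  refine ⟨fun h => h.parameterSet_eq hP hQ, ?_⟩
  rintro rfl
  obtain ⟨x, hx, -⟩ := hP.generated
  obtain ⟨y, hy, -⟩ := hQ.generated
  exact SU21.GKModule.isomorphic_of_isMinimal hM hN hP.casimir_eq hQ.casimir_eq hx hy
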